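/- Let $\mathsf{A}$ be an abelian category with a torsion pair $(\mathcal{T},\mathcal{F})$: $\mathcal{T},\mathcal{F}$ are isomorphism-closed full additive subcategories, $\operatorname{Hom}(T,F)=0$ for $T\in\mathcal{T}$, $F\in\mathcal{F}$, and every object $A$ sits in a short exact sequence $0\to T\to A\to F\to 0$ with $T\in\mathcal{T}$, $F\in\mathcal{F}$. **The category $\mathsf{B}$.** Objects are the two-term complexes $\mathbb{X}=[d\colon X^{-1}\to X^0]$ in $\mathsf{A}$ with $\ker d\in\mathcal{F}$ and $\operatorname{coker} d\in\mathcal{T}$. A morphism $\mathbb{X}\to\mathbb{Y}$ is an isomorphism class of butterflies $(E,\kappa,\iota,\sigma,\rho)$, where $\kappa\colon X^{-1}\to E$, $\iota\colon Y^{-1}\to E$, $\sigma\colon E\to X^0$, $\rho\colon E\to Y^0$ satisfy $\sigma\kappa=d$, $\rho\iota=d$, $\rho\kappa=0$, $\sigma\iota=0$, and $0\to Y^{-1}\xrightarrow{\iota}E\xrightarrow{\sigma}X^0\to0$ is exact; an isomorphism of butterflies is an isomorphism of the middle objects commuting with the four arrows. The composite of $(E,\kappa,\iota,\sigma,\rho)\colon\mathbb{X}\to\mathbb{Y}$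 and $(F,\kappa',\iota',\sigma',\rho')\colon\mathbb{Y}\to\mathbb{Z}$ has middle object $\operatorname{coker}\big((\iota,\kappa')\colon Y^{-1}\to E\times_{Y^0}F\big)$, with arrows induced by $(\kappa,0)$, $(0,\iota')$, $\sigma$ and $\rho'$. A morphism of complexes $f=(f^{-1},f^0)\colon\mathbb{X}\to\mathbb{Y}$ gives the *strict* morphism of $\mathsf{B}$ with middle object $X^0\oplus Y^{-1}$, $\kappa=(d,-f^{-1})$, $\iota=\mathrm{in}_2$, $\sigma=\mathrm{pr}_1$, $\rho=f^0+d$. **The category $\mathsf{Ch}^{st}(\mathsf{B})$.** Objects are the ($\mathbb{Z}$-indexed, cohomological) complexes $\mathbf{X}=({}^n\mathbb{X})_n$ in $\mathsf{B}$. A morphism $\mathbf{X}\to\mathbf{Y}$ is a family of morphisms of two-term complexes $f_n\colon{}^n\mathbb{X}\to{}^n\mathbb{Y}$ in $\mathsf{A}$ whose associated strict morphisms form a morphism of complexes in $\mathsf{B}$. Let $\mathcal{S}_{sis}$ be the class of morphisms that become isomorphisms in $\mathsf{Ch}(\mathsf{B})$, and $\mathcal{S}_{qis}$ the class of morphisms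 that become quasi-isomorphisms in $\mathsf{Ch}(\mathsf{B})$. **The category $\mathsf{Ch}(\mathsf{A},\mathcal{T},\mathcal{F})$.** A decorated complex $(E^\bullet,M^\bullet)$ is a complex $(E^\bullet,\delta)$ in $\mathsf{A}$ with subobjects $M^n\subseteq E^n$, $n\in\mathbb{Z}$, not necessarily respected by $\delta$; a morphism $(E^\bullet,M^\bullet)\to(F^\bullet,N^\bullet)$ is a chain map $f$ with $f(M^n)\subseteq N^n$ for all $n$. Let $H^{-1,n}$ and $H^{0,n}$ be the kernel and the cokernel of the map $M^n\to E^{n+1}/M^{n+1}$ induced by $\delta$. $\mathsf{Ch}(\mathsf{A},\mathcal{T},\mathcal{F})$ is the full subcategory of those $(E^\bullet,M^\bullet)$ with $H^{-1,n}\in\mathcal{F}$ and $H^{0,n}\in\mathcal{T}$ for all $n$. In it, let $\mathcal{S}_{sis}$ be the class of morphisms inducing isomorphisms on all $H^{-1,n}$ and $H^{0,n}$, and $\mathcal{S}_{qis}$ the class of morphisms for which $E^\bullet\to F^\bullet$ is a quasi-isomorphism. **The functor $\operatorname{Tot}$.** Given $\mathbf{X}$, choose a butterfly with middle object $E^n$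 representing the differential ${}^{n-1}\mathbb{X}\to{}^n\mathbb{X}$, and write $\kappa_n,\iota_n,\sigma_n,\rho_n$ for its arrows. Put $M^n=\iota_n({}^nX^{-1})\subseteq E^n$, and let $\delta\colon E^n\to E^{n+1}$ be the unique morphism with $\delta\kappa_n=0$, $\delta\iota_n=\kappa_{n+1}$, $\sigma_{n+1}\delta=\rho_n$ and $\rho_{n+1}\delta=0$. Then $\operatorname{Tot}(\mathbf{X})=(E^\bullet,M^\bullet)$. A morphism $(f_n)_n\colon\mathbf{X}\to\mathbf{Y}$ is sent to the family of the unique morphisms between the middle objects in degree $n$ that are compatible, via $\kappa_n,\iota_n,\sigma_n,\rho_n$, with $f_{n-1}$ and $f_n$. **Theorem.** $\operatorname{Tot}\colon\mathsf{Ch}^{st}(\mathsf{B})\to\mathsf{Ch}(\mathsf{A},\mathcal{T},\mathcal{F})$ is an equivalence of categories. Under it, $\mathcal{S}_{sis}$ and $\mathcal{S}_{qis}$ in $\mathsf{Ch}^{st}(\mathsf{B})$ correspond exactly to $\mathcal{S}_{sis}$ and $\mathcal{S}_{qis}$ in $\mathsf{Ch}(\mathsf{A},\mathcal{T},\mathcal{F})$: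 a morphism $s$ of $\mathsf{Ch}^{st}(\mathsf{B})$ lies in $\mathcal{S}_{sis}$ (resp. $\mathcal{S}_{qis}$) if and only if $\operatorname{Tot}(s)$ does, and the image of each class under $\operatorname{Tot}$, closed under isomorphism of arrows, is the whole corresponding class. -/

import Mathlib

open CategoryTheory CategoryTheory.Limits

attribute [-instance] CategoryTheory.catToReflQuiver

universe v u

noncomputable section

namespace HRSTilt

variable {A : Type u} [Category.{v} A] [Abelian A]

/-- A torsion pair `(𝒯, ℱ)` in an abelian category: two (isomorphism-closed) full subcategories,
given by their object classes, without nonzero morphisms from `𝒯` to `ℱ`, and such that every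
object is an extension of an object of `ℱ` by an object of `𝒯`.  (Both classes then
automatically contain zero and are closed under finite direct sums.) -/
structure TorsionPair (A : Type u) [Category.{v} A] [Abelian A] where
  T : ObjectProperty A
  F : ObjectProperty A
  T_iso : T.IsClosedUnderIsomorphisms
  F_iso : F.IsClosedUnderIsomorphisms
  hom_eq_zero : ∀ {X Y : A}, T X → F Y → ∀ f : X ⟶ Y, f = 0
  exists_shortExact : ∀ X : A, ∃ S : ShortComplex A, S.ShortExact ∧ S.X₂ = X ∧ T S.X₁ ∧ F S.X₃

/-! ### Butterflies -/

/-- A butterfly from the two-term complex `X = [X⁻¹ ⟶ X⁰]` to `Y = [Y⁻¹ ⟶ Y⁰]` (two-term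
complexes are encoded as arrows): both diagonals compose to zero, and
`0 ⟶ Y⁻¹ ⟶ E ⟶ X⁰ ⟶ 0` is short exact. -/
structure Butterfly (X Y : Arrow A) where
  E : A
  κ : X.left ⟶ E
  ι : Y.left ⟶ E
  σ : E ⟶ X.right
  ρ : E ⟶ Y.right
  κ_σ : κ ≫ σ = X.hom
  ι_ρ : ι ≫ ρ = Y.hom
  κ_ρ : κ ≫ ρ = 0
  ι_σ : ι ≫ σ = 0
  exact : (ShortComplex.mk ι σ ι_σ).ShortExact

namespace Butterfly

variable {X Y Z W : Arrow A}

instance (P : Butterfly X Y) : Mono P.ι := P.exact.mono_f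
instance (P : Butterfly X Y) : Epi P.σ := P.exact.epi_g

/-- Two butterflies are isomorphic if there is an isomorphism of their middle objects that
commutes with all four arrows. -/
def Iso (P Q : Butterfly X Y) : Prop :=
  ∃ e : P.E ≅ Q.E, P.κ ≫ e.hom = Q.κ ∧ P.ι ≫ e.hom = Q.ι ∧
    e.hom ≫ Q.σ = P.σ ∧ e.hom ≫ Q.ρ = P.ρ

instance setoid (X Y : Arrow A) : Setoid (Butterfly X Y) where
  r := Iso
  iseqv :=
    { refl := fun P => ⟨CategoryTheory.Iso.refl _, by simp⟩
      symm := by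
        rintro P Q ⟨e, h1, h2, h3, h4⟩
        exact ⟨e.symm, by simp [← h1], by simp [← h2], by simp [← h3], by simp [← h4]⟩
      trans := by
        rintro P Q R ⟨e, h1, h2, h3, h4⟩ ⟨e', h1', h2', h3', h4'⟩
        exact ⟨e ≪≫ e', by simp [← h1', ← h1], by simp [← h2', ← h2], by simp [h3', h3],
          by simp [h4', h4]⟩ }

/-- By the short five lemma, a map commuting with the four arrows is an isomorphism. -/
lemma iso_of_hom {P Q : Butterfly X Y} (f : P.E ⟶ Q.E) (h1 : P.κ ≫ f = Q.κ)
    (h2 : P.ι ≫ f = Q.ι) (h3 : f ≫ Q.σ = P.σ) (h4 : f ≫ Q.ρ = P.ρ) : P ≈ Q := by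
  let φ : ShortComplex.mk P.ι P.σ P.ι_σ ⟶ ShortComplex.mk Q.ι Q.σ Q.ι_σ :=
    { τ₁ := 𝟙 _, τ₂ := f, τ₃ := 𝟙 _, comm₁₂ := by simp [h2], comm₂₃ := by simp [h3] }
  have : IsIso φ.τ₁ := inferInstanceAs (IsIso (𝟙 _))
  have : IsIso φ.τ₃ := inferInstanceAs (IsIso (𝟙 _))
  have : IsIso f := ShortComplex.isIso₂_of_shortExact_of_isIso₁₃ φ P.exact Q.exact
  exact ⟨asIso f, h1, h2, h3, h4⟩

/-- The butterfly of an actual morphism of two-term complexes. -/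
abbrev ofHom (f : X ⟶ Y) : Butterfly X Y where
  E := X.right ⊞ Y.left
  κ := biprod.lift X.hom (-f.left)
  ι := biprod.inr
  σ := biprod.fst
  ρ := biprod.desc f.right Y.hom
  κ_σ := by simp
  ι_ρ := by simp
  κ_ρ := by simp [biprod.lift_desc]
  ι_σ := by simp
  exact := (ShortComplex.Splitting.mk (S := ShortComplex.mk (biprod.inr : Y.left ⟶ X.right ⊞ Y.left)
    biprod.fst (by simp)) biprod.snd biprod.inl (by simp) (by simp)
      (by rw [add_comm]; exact biprod.total)).shortExact

/-- The map `Y⁻¹ ⟶ E ×_{Y⁰} F` with components `ι` and `κ'`. -/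
def compRel (P : Butterfly X Y) (Q : Butterfly Y Z) : Y.left ⟶ pullback P.ρ Q.σ :=
  pullback.lift P.ι Q.κ (by rw [P.ι_ρ, Q.κ_σ])

/-- The middle object of the composition: the quotient by `Y⁻¹` of the fibre product
`E ×_{Y⁰} F`. -/
abbrev compObj (P : Butterfly X Y) (Q : Butterfly Y Z) : A := cokernel (compRel P Q)

section

variable (P : Butterfly X Y) (Q : Butterfly Y Z)

lemma compRel_fst : compRel P Q ≫ pullback.fst _ _ = P.ι := by simp [compRel, pullback.lift_fst]

lemma compRel_snd : compRel P Q ≫ pullback.snd _ _ = Q.κ := by simp [compRel, pullback.lift_snd]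

def compκ : X.left ⟶ pullback P.ρ Q.σ := pullback.lift P.κ 0 (by simp [P.κ_ρ])

def compι : Z.left ⟶ pullback P.ρ Q.σ := pullback.lift 0 Q.ι (by simp [Q.ι_σ])

lemma compκ_fst : compκ P Q ≫ pullback.fst _ _ = P.κ := by simp [compκ, pullback.lift_fst]
lemma compκ_snd : compκ P Q ≫ pullback.snd _ _ = 0 := by simp [compκ, pullback.lift_snd]
lemma compι_fst : compι P Q ≫ pullback.fst _ _ = 0 := by simp [compι, pullback.lift_fst]
lemma compι_snd : compι P Q ≫ pullback.snd _ _ = Q.ι := by simp [compι, pullback.lift_snd]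

def compσ : compObj P Q ⟶ X.right :=
  cokernel.desc _ (pullback.fst _ _ ≫ P.σ) (by rw [reassoc_of% @compRel_fst, P.ι_σ])

def compρ : compObj P Q ⟶ Z.right :=
  cokernel.desc _ (pullback.snd _ _ ≫ Q.ρ) (by rw [reassoc_of% @compRel_snd, Q.κ_ρ])

lemma π_compσ : cokernel.π (compRel P Q) ≫ compσ P Q = pullback.fst _ _ ≫ P.σ := by
  simp [compσ]

lemma π_compρ : cokernel.π (compRel P Q) ≫ compρ P Q = pullback.snd _ _ ≫ Q.ρ := by
  simp [compρ]

lemma exists_of_π_eq_zero {T : A} (x : T ⟶ pullback P.ρ Q.σ)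
    (hx : x ≫ cokernel.π (compRel P Q) = 0) :
    ∃ (T' : A) (π : T' ⟶ T) (_ : Epi π) (b : T' ⟶ Y.left), π ≫ x = b ≫ compRel P Q :=
  (ShortComplex.exact_cokernel (compRel P Q)).exact_up_to_refinements x hx

lemma comp_ι_mono : Mono (compι P Q ≫ cokernel.π (compRel P Q)) := by
  rw [Preadditive.mono_iff_cancel_zero]
  intro T z hz
  obtain ⟨T', π, _, b, hb⟩ := exists_of_π_eq_zero P Q (z ≫ compι P Q) (by simpa using hz)
  have h1 : b = 0 := by
    rw [← cancel_mono P.ι, zero_comp, ← compRel_fst P Q, ← Category.assoc, ← hb]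
    simp [compι_fst]
  rw [← cancel_epi π, ← cancel_mono Q.ι, ← compι_snd P Q]
  have := hb =≫ pullback.snd _ _
  simpa [h1] using this

lemma comp_ι_σ : (compι P Q ≫ cokernel.π (compRel P Q)) ≫ compσ P Q = 0 := by
  rw [Category.assoc, π_compσ, reassoc_of% @compι_fst, zero_comp]

lemma comp_exact :
    (ShortComplex.mk (compι P Q ≫ cokernel.π (compRel P Q)) (compσ P Q)
      (comp_ι_σ P Q)).ShortExact := by
  have := comp_ι_mono P Q
  have : Epi (compσ P Q) := by
    have h : Epi (cokernel.π (compRel P Q) ≫ compσ P Q) := by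
      rw [π_compσ]; exact epi_comp _ _
    exact epi_of_epi (cokernel.π (compRel P Q)) _
  refine ⟨?_⟩
  rw [ShortComplex.exact_iff_exact_up_to_refinements]
  intro T c hc
  dsimp at c hc ⊢
  obtain ⟨T', π, hπ, l, hl⟩ :=
    surjective_up_to_refinements_of_epi (cokernel.π (compRel P Q)) c
  have h0 : (l ≫ pullback.fst _ _) ≫ P.σ = 0 := by
    rw [Category.assoc, ← π_compσ, ← Category.assoc, ← hl, Category.assoc, hc, comp_zero]
  obtain ⟨b, hb⟩ : ∃ b, b ≫ P.ι = l ≫ pullback.fst _ _ :=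
    ⟨P.exact.exact.lift _ h0, P.exact.exact.lift_f _ h0⟩
  have h1 : (l ≫ pullback.snd _ _ - b ≫ Q.κ) ≫ Q.σ = 0 := by
    rw [Preadditive.sub_comp, Category.assoc, ← pullback.condition, ← Category.assoc, ← hb]
    simp [P.ι_ρ, Q.κ_σ]
  obtain ⟨z, hz⟩ : ∃ z, z ≫ Q.ι = l ≫ pullback.snd _ _ - b ≫ Q.κ :=
    ⟨Q.exact.exact.lift _ h1, Q.exact.exact.lift_f _ h1⟩
  refine ⟨T', π, hπ, z, ?_⟩
  have h2 : l = z ≫ compι P Q + b ≫ compRel P Q := by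
    apply pullback.hom_ext
    · simp [compι_fst, compRel_fst, hb]
    · simp [compι_snd, compRel_snd, hz]
  rw [hl, h2]
  simp

/-- The composition of butterflies. -/
def comp : Butterfly X Z where
  E := compObj P Q
  κ := compκ P Q ≫ cokernel.π _
  ι := compι P Q ≫ cokernel.π _
  σ := compσ P Q
  ρ := compρ P Q
  κ_σ := by rw [Category.assoc, π_compσ, reassoc_of% @compκ_fst, P.κ_σ]
  ι_ρ := by rw [Category.assoc, π_compρ, reassoc_of% @compι_snd, Q.ι_ρ]
  κ_ρ := by rw [Category.assoc, π_compρ, reassoc_of% @compκ_snd, zero_comp]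
  ι_σ := comp_ι_σ P Q
  exact := comp_exact P Q

/-- The quotient map from the fibre product to the middle object of the composition. -/
def compπ : pullback P.ρ Q.σ ⟶ (comp P Q).E := cokernel.π (compRel P Q)

instance : Epi (compπ P Q) := inferInstanceAs (Epi (cokernel.π _))

/-- A map exhibiting `R` as the composition of `P` and `Q`. -/
structure IsComp (R : Butterfly X Z) (r : pullback P.ρ Q.σ ⟶ R.E) : Prop where
  rel : compRel P Q ≫ r = 0
  κ : compκ P Q ≫ r = R.κ
  ι : compι P Q ≫ r = R.ι
  σ : r ≫ R.σ = pullback.fst _ _ ≫ P.σ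
  ρ : r ≫ R.ρ = pullback.snd _ _ ≫ Q.ρ

lemma isComp_comp : IsComp P Q (comp P Q) (compπ P Q) :=
  ⟨cokernel.condition _, rfl, rfl, π_compσ P Q, π_compρ P Q⟩

variable {P Q} in
lemma IsComp.equiv {R : Butterfly X Z} {r : pullback P.ρ Q.σ ⟶ R.E} (h : IsComp P Q R r) :
    comp P Q ≈ R := by
  have hc := isComp_comp P Q
  obtain ⟨f, hf⟩ : ∃ f : (comp P Q).E ⟶ R.E, compπ P Q ≫ f = r :=
    ⟨cokernel.desc _ r h.rel, cokernel.π_desc _ _ _⟩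
  refine iso_of_hom f ?_ ?_ ?_ ?_
  · rw [← hc.κ, Category.assoc, hf, h.κ]
  · rw [← hc.ι, Category.assoc, hf, h.ι]
  · rw [← cancel_epi (compπ P Q), reassoc_of% hf, h.σ, hc.σ]
  · rw [← cancel_epi (compπ P Q), reassoc_of% hf, h.ρ, hc.ρ]

end

lemma comp_congr {P P' : Butterfly X Y} {Q Q' : Butterfly Y Z} (h : P ≈ P') (h' : Q ≈ Q') :
    comp P Q ≈ comp P' Q' := by
  obtain ⟨e, h1, h2, h3, h4⟩ := h
  obtain ⟨e', h1', h2', h3', h4'⟩ := h'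
  obtain ⟨m, hm1, hm2⟩ : ∃ m : pullback P.ρ Q.σ ⟶ pullback P'.ρ Q'.σ,
      m ≫ pullback.fst _ _ = pullback.fst _ _ ≫ e.hom ∧
      m ≫ pullback.snd _ _ = pullback.snd _ _ ≫ e'.hom :=
    ⟨pullback.lift (pullback.fst _ _ ≫ e.hom) (pullback.snd _ _ ≫ e'.hom)
      (by rw [Category.assoc, h4, Category.assoc, h3', pullback.condition]),
      pullback.lift_fst _ _ _, pullback.lift_snd _ _ _⟩
  have hc := isComp_comp P' Q'
  refine IsComp.equiv (r := m ≫ compπ P' Q') ⟨?_, ?_, ?_, ?_, ?_⟩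
  · have : compRel P Q ≫ m = compRel P' Q' := by
      apply pullback.hom_ext
      · rw [Category.assoc, hm1, reassoc_of% @compRel_fst, compRel_fst, h2]
      · rw [Category.assoc, hm2, reassoc_of% @compRel_snd, compRel_snd, h1']
    rw [reassoc_of% this, hc.rel]
  · have : compκ P Q ≫ m = compκ P' Q' := by
      apply pullback.hom_ext
      · rw [Category.assoc, hm1, reassoc_of% @compκ_fst, compκ_fst, h1]
      · rw [Category.assoc, hm2, reassoc_of% @compκ_snd, compκ_snd, zero_comp]
    rw [reassoc_of% this, hc.κ]
  · have : compι P Q ≫ m = compι P' Q' := by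
      apply pullback.hom_ext
      · rw [Category.assoc, hm1, reassoc_of% @compι_fst, compι_fst, zero_comp]
      · rw [Category.assoc, hm2, reassoc_of% @compι_snd, compι_snd, h2']
    rw [reassoc_of% this, hc.ι]
  · rw [Category.assoc, hc.σ, reassoc_of% hm1, h3]
  · rw [Category.assoc, hc.ρ, reassoc_of% hm2, h4']

/-- Postcomposition with a strict morphism `g` only requires a map `E ⟶ R` that is
compatible with `g`. -/
lemma comp_ofHom_equiv {P : Butterfly X Y} {g : Y ⟶ Z} {R : Butterfly X Z} (φ : P.E ⟶ R.E)
    (hκ : P.κ ≫ φ = R.κ) (hι : P.ι ≫ φ = g.left ≫ R.ι) (hσ : φ ≫ R.σ = P.σ)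
    (hρ : φ ≫ R.ρ = P.ρ ≫ g.right) : comp P (ofHom g) ≈ R := by
  refine IsComp.equiv (r := pullback.fst P.ρ (ofHom g).σ ≫ φ +
    pullback.snd P.ρ (ofHom g).σ ≫ biprod.snd ≫ R.ι) ⟨?_, ?_, ?_, ?_, ?_⟩
  · rw [Preadditive.comp_add, reassoc_of% @compRel_fst, reassoc_of% @compRel_snd]
    simp [hι]
  · rw [Preadditive.comp_add, reassoc_of% @compκ_fst, reassoc_of% @compκ_snd]
    simp [hκ]
  · rw [Preadditive.comp_add, reassoc_of% @compι_fst, reassoc_of% @compι_snd]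
    simp
  · simp [R.ι_σ, hσ]
  · have h : pullback.fst P.ρ (ofHom g).σ ≫ P.ρ = pullback.snd _ _ ≫ biprod.fst :=
      pullback.condition
    rw [Preadditive.add_comp, Category.assoc, hρ, reassoc_of% h]
    simp only [Category.assoc, R.ι_ρ, ← Preadditive.comp_add]
    congr 1
    apply biprod.hom_ext' <;> simp

/-- Precomposition with a strict morphism `f` only requires a map `R ⟶ F` that is
compatible with `f`. -/
lemma ofHom_comp_equiv {f : X ⟶ Y} {Q : Butterfly Y Z} {R : Butterfly X Z} (φ : R.E ⟶ Q.E)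
    (hκ : R.κ ≫ φ = f.left ≫ Q.κ) (hι : R.ι ≫ φ = Q.ι) (hσ : φ ≫ Q.σ = R.σ ≫ f.right)
    (hρ : φ ≫ Q.ρ = R.ρ) : comp (ofHom f) Q ≈ R := by
  have hc := isComp_comp (ofHom f) Q
  obtain ⟨m, hm1, hm2⟩ : ∃ m : R.E ⟶ pullback (ofHom f).ρ Q.σ,
      m ≫ pullback.fst _ _ = biprod.lift R.σ 0 ∧ m ≫ pullback.snd _ _ = φ :=
    ⟨pullback.lift (biprod.lift R.σ 0) φ (by simp [hσ]), pullback.lift_fst _ _ _,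
      pullback.lift_snd _ _ _⟩
  symm
  refine iso_of_hom (m ≫ compπ (ofHom f) Q) ?_ ?_ ?_ ?_
  · have : R.κ ≫ m = compκ (ofHom f) Q + f.left ≫ compRel (ofHom f) Q := by
      apply pullback.hom_ext
      · rw [Category.assoc, hm1, Preadditive.add_comp, compκ_fst, Category.assoc, compRel_fst]
        apply biprod.hom_ext <;> simp [R.κ_σ]
      · rw [Category.assoc, hm2, Preadditive.add_comp, compκ_snd, Category.assoc, compRel_snd,
          hκ, zero_add]
    rw [reassoc_of% this, Preadditive.add_comp, Category.assoc, hc.rel, hc.κ, comp_zero, add_zero]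
  · have : R.ι ≫ m = compι (ofHom f) Q := by
      apply pullback.hom_ext
      · rw [Category.assoc, hm1, compι_fst]
        apply biprod.hom_ext <;> simp [R.ι_σ]
      · rw [Category.assoc, hm2, compι_snd, hι]
    rw [reassoc_of% this, hc.ι]
  · rw [Category.assoc, hc.σ, reassoc_of% hm1]
    simp
  · rw [Category.assoc, hc.ρ, reassoc_of% hm2, hρ]

lemma comp_id (P : Butterfly X Y) : comp P (ofHom (𝟙 Y)) ≈ P :=
  comp_ofHom_equiv (𝟙 _) (by simp) (by simp) (by simp) (by simp)

lemma id_comp (P : Butterfly X Y) : comp (ofHom (𝟙 X)) P ≈ P :=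
  ofHom_comp_equiv (𝟙 _) (by simp) (by simp) (by simp) (by simp)

lemma ofHom_comp_ofHom (f : X ⟶ Y) (g : Y ⟶ Z) :
    comp (ofHom f) (ofHom g) ≈ ofHom (f ≫ g) := by
  refine comp_ofHom_equiv (biprod.map (𝟙 _) g.left) ?_ ?_ ?_ ?_
  · apply biprod.hom_ext <;> simp
  · simp
  · simp
  · apply biprod.hom_ext' <;> simp

/-- The zero morphism of two-term complexes. -/
def zeroHom (X Y : Arrow A) : X ⟶ Y := Arrow.homMk 0 0 (by simp)

lemma comp_zero' (P : Butterfly X Y) : comp P (ofHom (zeroHom Y Z)) ≈ ofHom (zeroHom X Z) := by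
  refine comp_ofHom_equiv (biprod.lift P.σ 0) ?_ ?_ ?_ ?_
  · apply biprod.hom_ext <;> simp [zeroHom, P.κ_σ]
  · apply biprod.hom_ext <;> simp [zeroHom, P.ι_σ]
  · simp
  · simp [zeroHom]

lemma zero_comp' (P : Butterfly Y Z) : comp (ofHom (zeroHom X Y)) P ≈ ofHom (zeroHom X Z) := by
  refine ofHom_comp_equiv (biprod.snd ≫ P.ι) ?_ ?_ ?_ ?_
  · simp [zeroHom]
  · simp
  · simp [zeroHom, P.ι_σ]
  · apply biprod.hom_ext' <;> simp [zeroHom, P.ι_ρ]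

lemma assoc_aux {P : Butterfly X Y} {Q : Butterfly Y Z} {R : Butterfly Z W}
    {C : Butterfly X Z} {p : pullback P.ρ Q.σ ⟶ C.E} (hC : IsComp P Q C p) [Epi p]
    (hp : ∀ {T : A} (x : T ⟶ pullback P.ρ Q.σ), x ≫ p = 0 →
      ∃ (T' : A) (π : T' ⟶ T) (_ : Epi π) (b : T' ⟶ Y.left), π ≫ x = b ≫ compRel P Q)
    {D : Butterfly Y W} {p' : pullback Q.ρ R.σ ⟶ D.E} (hD : IsComp Q R D p')
    {H : Butterfly X W} {p'' : pullback P.ρ D.σ ⟶ H.E} (hH : IsComp P D H p'') :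
    comp C R ≈ H := by
  -- `L` is the triple fibre product, with projections `a`, `b`, `c`
  obtain ⟨L, q, l, hq, _, hL⟩ : ∃ (L : A) (q : L ⟶ pullback C.ρ R.σ) (l : L ⟶ pullback P.ρ Q.σ),
      q ≫ pullback.fst _ _ = l ≫ p ∧ Epi q ∧ ∀ {T : A} (u : T ⟶ pullback P.ρ Q.σ)
        (w : T ⟶ pullback C.ρ R.σ), u ≫ p = w ≫ pullback.fst _ _ →
        ∃ x : T ⟶ L, x ≫ l = u ∧ x ≫ q = w :=
    ⟨pullback p (pullback.fst C.ρ R.σ), pullback.snd _ _, pullback.fst _ _,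
      pullback.condition.symm, inferInstance,
      fun u w h => ⟨pullback.lift u w h, pullback.lift_fst _ _ _, pullback.lift_snd _ _ _⟩⟩
  obtain ⟨a, ha⟩ : ∃ a, l ≫ pullback.fst _ _ = a := ⟨_, rfl⟩
  obtain ⟨b, hb⟩ : ∃ b, l ≫ pullback.snd _ _ = b := ⟨_, rfl⟩
  obtain ⟨c, hc⟩ : ∃ c, q ≫ pullback.snd _ _ = c := ⟨_, rfl⟩
  have hab : a ≫ P.ρ = b ≫ Q.σ := by
    rw [← ha, ← hb, Category.assoc, Category.assoc, pullback.condition]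
  have hbc : b ≫ Q.ρ = c ≫ R.σ := by
    rw [← hb, ← hc, Category.assoc, Category.assoc, ← hC.ρ, ← reassoc_of% hq, pullback.condition]
  obtain ⟨bc, hbc1, hbc2⟩ : ∃ bc : L ⟶ pullback Q.ρ R.σ,
      bc ≫ pullback.fst _ _ = b ∧ bc ≫ pullback.snd _ _ = c :=
    ⟨pullback.lift b c hbc, pullback.lift_fst _ _ _, pullback.lift_snd _ _ _⟩
  obtain ⟨abc, habc1, habc2⟩ : ∃ abc : L ⟶ pullback P.ρ D.σ,
      abc ≫ pullback.fst _ _ = a ∧ abc ≫ pullback.snd _ _ = bc ≫ p' :=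
    ⟨pullback.lift a (bc ≫ p') (by rw [Category.assoc, hD.σ, hab, reassoc_of% hbc1]),
      pullback.lift_fst _ _ _, pullback.lift_snd _ _ _⟩
  have key : ∀ {T : A} (x : T ⟶ L) (y : T ⟶ Y.left) (z : T ⟶ Z.left) (x' : T ⟶ X.left)
      (w : T ⟶ W.left),
      x ≫ a = y ≫ P.ι + x' ≫ P.κ → x ≫ b = y ≫ Q.κ + z ≫ Q.ι → x ≫ c = z ≫ R.κ + w ≫ R.ι →
      x ≫ abc ≫ p'' = x' ≫ H.κ + w ≫ H.ι := by
    intro T x y z x' w ha hb hc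
    have e1 : x ≫ bc = y ≫ compκ Q R + z ≫ compRel Q R + w ≫ compι Q R := by
      apply pullback.hom_ext
      · simp [hbc1, hb, compκ_fst, compRel_fst, compι_fst]
      · simp [hbc2, hc, compκ_snd, compRel_snd, compι_snd]
    have e2 : x ≫ bc ≫ p' = y ≫ D.κ + w ≫ D.ι := by
      rw [reassoc_of% e1]
      simp [hD.κ, hD.ι, hD.rel]
    have e3 : x ≫ abc = x' ≫ compκ P D + y ≫ compRel P D + w ≫ compι P D := by
      apply pullback.hom_ext
      · rw [Category.assoc, habc1, ha]
        simp [compκ_fst, compRel_fst, compι_fst, add_comm]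
      · rw [Category.assoc, habc2, e2]
        simp [compκ_snd, compRel_snd, compι_snd]
    rw [reassoc_of% e3]
    simp [hH.κ, hH.ι, hH.rel]
  have hker : kernel.ι q ≫ abc ≫ p'' = 0 := by
    obtain ⟨T', π, _, y, hy⟩ := hp (kernel.ι q ≫ l)
      (by rw [Category.assoc, ← hq, kernel.condition_assoc, zero_comp])
    rw [← cancel_epi π, comp_zero]
    have := key (π ≫ kernel.ι q) y 0 0 0 ?_ ?_ ?_
    · simpa using this
    · have := hy =≫ pullback.fst _ _
      simpa [compRel_fst, ha] using this
    · have := hy =≫ pullback.snd _ _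
      simpa [compRel_snd, hb] using this
    · simp [← hc]
  obtain ⟨r, hr⟩ : ∃ r, q ≫ r = abc ≫ p'' :=
    ⟨Abelian.epiDesc q _ hker, Abelian.comp_epiDesc q _ hker⟩
  refine IsComp.equiv (r := r) ⟨?_, ?_, ?_, ?_, ?_⟩
  · obtain ⟨x, hx, hx'⟩ := hL (compι P Q) (compRel C R) (by rw [compRel_fst, hC.ι])
    rw [← hx', Category.assoc, hr]
    have := key x 0 (𝟙 _) 0 0 (by rw [← ha, reassoc_of% hx, compι_fst]; simp)
      (by rw [← hb, reassoc_of% hx, compι_snd]; simp)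
      (by rw [← hc, reassoc_of% hx', compRel_snd]; simp)
    simpa using this
  · obtain ⟨x, hx, hx'⟩ := hL (compκ P Q) (compκ C R) (by rw [compκ_fst, hC.κ])
    rw [← hx', Category.assoc, hr]
    have := key x 0 0 (𝟙 _) 0 (by rw [← ha, reassoc_of% hx, compκ_fst]; simp)
      (by rw [← hb, reassoc_of% hx, compκ_snd]; simp)
      (by rw [← hc, reassoc_of% hx', compκ_snd]; simp)
    simpa using this
  · obtain ⟨x, hx, hx'⟩ := hL 0 (compι C R) (by rw [compι_fst, zero_comp])
    rw [← hx', Category.assoc, hr]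
    have := key x 0 0 0 (𝟙 _) (by rw [← ha, reassoc_of% hx]; simp)
      (by rw [← hb, reassoc_of% hx]; simp)
      (by rw [← hc, reassoc_of% hx', compι_snd]; simp)
    simpa using this
  · rw [← cancel_epi q, reassoc_of% hr, hH.σ, reassoc_of% habc1, reassoc_of% hq, hC.σ,
      reassoc_of% ha]
  · rw [← cancel_epi q, reassoc_of% hr, hH.ρ, reassoc_of% habc2, hD.ρ, reassoc_of% hbc2,
      reassoc_of% hc]

lemma assoc (P : Butterfly X Y) (Q : Butterfly Y Z) (R : Butterfly Z W) :
    comp (comp P Q) R ≈ comp P (comp Q R) :=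
  assoc_aux (isComp_comp P Q) (exists_of_π_eq_zero P Q) (isComp_comp Q R)
    (isComp_comp P (comp Q R))

/-- If the composition of two butterflies is the zero morphism, there is a link between them. -/
lemma exists_link {P : Butterfly X Y} {Q : Butterfly Y Z}
    (h : comp P Q ≈ ofHom (zeroHom X Z)) :
    ∃ δ : P.E ⟶ Q.E, P.κ ≫ δ = 0 ∧ P.ι ≫ δ = Q.κ ∧ δ ≫ Q.σ = P.ρ ∧ δ ≫ Q.ρ = 0 := by
  have hc := isComp_comp P Q
  obtain ⟨e, h1, h2, h3, h4⟩ := h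
  obtain ⟨s, hs⟩ : ∃ s, compπ P Q ≫ e.hom ≫ biprod.snd = s := ⟨_, rfl⟩
  have sκ : compκ P Q ≫ s = 0 := by
    rw [← hs, reassoc_of% hc.κ, reassoc_of% h1]; simp [zeroHom]
  have sι : compι P Q ≫ s = 𝟙 _ := by
    rw [← hs, reassoc_of% hc.ι, reassoc_of% h2]; simp
  have srel : compRel P Q ≫ s = 0 := by
    rw [← hs, reassoc_of% hc.rel, zero_comp]
  have sρ : s ≫ Z.hom = pullback.snd _ _ ≫ Q.ρ := by
    rw [← hc.ρ, ← h4, ← hs, Category.assoc, Category.assoc]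
    congr 2
    apply biprod.hom_ext' <;> simp [zeroHom]
  obtain ⟨g, hg⟩ : ∃ g, pullback.snd P.ρ Q.σ - s ≫ Q.ι = g := ⟨_, rfl⟩
  have hker : kernel.ι (pullback.fst P.ρ Q.σ) ≫ g = 0 := by
    have h0 : (kernel.ι (pullback.fst P.ρ Q.σ) ≫ pullback.snd _ _) ≫ Q.σ = 0 := by
      rw [Category.assoc, ← pullback.condition, kernel.condition_assoc, zero_comp]
    obtain ⟨z, hz⟩ : ∃ z, z ≫ Q.ι = kernel.ι (pullback.fst P.ρ Q.σ) ≫ pullback.snd _ _ :=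
      ⟨Q.exact.exact.lift _ h0, Q.exact.exact.lift_f _ h0⟩
    have : kernel.ι (pullback.fst P.ρ Q.σ) = z ≫ compι P Q := by
      apply pullback.hom_ext
      · simp [compι_fst]
      · simp [compι_snd, hz]
    rw [this, ← hg, Category.assoc, Preadditive.comp_sub, compι_snd, reassoc_of% sι, sub_self,
      comp_zero]
  obtain ⟨δ, hδ⟩ : ∃ δ, pullback.fst P.ρ Q.σ ≫ δ = g :=
    ⟨Abelian.epiDesc _ _ hker, Abelian.comp_epiDesc _ _ hker⟩
  refine ⟨δ, ?_, ?_, ?_, ?_⟩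
  · rw [← compκ_fst P Q, Category.assoc, hδ, ← hg, Preadditive.comp_sub, compκ_snd,
      reassoc_of% sκ, zero_comp, sub_zero]
  · rw [← compRel_fst P Q, Category.assoc, hδ, ← hg, Preadditive.comp_sub, compRel_snd,
      reassoc_of% srel, zero_comp, sub_zero]
  · rw [← cancel_epi (pullback.fst P.ρ Q.σ), reassoc_of% hδ, ← hg, Preadditive.sub_comp,
      Category.assoc, Q.ι_σ, comp_zero, sub_zero, pullback.condition]
  · rw [← cancel_epi (pullback.fst P.ρ Q.σ), reassoc_of% hδ, ← hg, Preadditive.sub_comp,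
      Category.assoc, Q.ι_ρ, sρ, sub_self, comp_zero]

/-- A commutative square with two strict sides induces a map of middle objects. -/
lemma exists_map {P : Butterfly X Y} {g : Y ⟶ Z} {f : X ⟶ W} {Q : Butterfly W Z}
    (h : comp P (ofHom g) ≈ comp (ofHom f) Q) :
    ∃ φ : P.E ⟶ Q.E, P.κ ≫ φ = f.left ≫ Q.κ ∧ P.ι ≫ φ = g.left ≫ Q.ι ∧
      φ ≫ Q.σ = P.σ ≫ f.right ∧ φ ≫ Q.ρ = P.ρ ≫ g.right := by
  have hc := isComp_comp P (ofHom g)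
  have hc' := isComp_comp (ofHom f) Q
  obtain ⟨e, h1, h2, h3, h4⟩ := h
  obtain ⟨m, hm1, hm2⟩ : ∃ m : P.E ⟶ pullback P.ρ (ofHom g).σ,
      m ≫ pullback.fst _ _ = 𝟙 _ ∧ m ≫ pullback.snd _ _ = biprod.lift P.ρ 0 :=
    ⟨pullback.lift (𝟙 _) (biprod.lift P.ρ 0) (by simp), pullback.lift_fst _ _ _,
      pullback.lift_snd _ _ _⟩
  obtain ⟨n, hn⟩ : ∃ n : (comp (ofHom f) Q).E ⟶ Q.E, compπ (ofHom f) Q ≫ n =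
      pullback.snd (ofHom f).ρ Q.σ - pullback.fst (ofHom f).ρ Q.σ ≫ biprod.snd ≫ Q.κ := by
    refine ⟨cokernel.desc _ _ ?_, cokernel.π_desc _ _ _⟩
    rw [Preadditive.comp_sub, compRel_snd, reassoc_of% @compRel_fst]
    simp
  refine ⟨m ≫ compπ P (ofHom g) ≫ e.hom ≫ n, ?_, ?_, ?_, ?_⟩
  · have : P.κ ≫ m = compκ P (ofHom g) := by
      apply pullback.hom_ext
      · rw [Category.assoc, hm1, compκ_fst, Category.comp_id]
      · rw [Category.assoc, hm2, compκ_snd]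
        apply biprod.hom_ext <;> simp [P.κ_ρ]
    rw [reassoc_of% this, reassoc_of% hc.κ, reassoc_of% h1, ← hc'.κ, Category.assoc, hn,
      Preadditive.comp_sub, compκ_snd, reassoc_of% @compκ_fst]
    simp
  · have : P.ι ≫ m = compRel P (ofHom g) + g.left ≫ compι P (ofHom g) := by
      apply pullback.hom_ext
      · rw [Category.assoc, hm1, Preadditive.add_comp, Category.assoc, compRel_fst, compι_fst]
        simp
      · rw [Category.assoc, hm2, Preadditive.add_comp, Category.assoc, compRel_snd, compι_snd]
        apply biprod.hom_ext <;> simp [P.ι_ρ]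
    rw [reassoc_of% this, Preadditive.add_comp, reassoc_of% hc.rel, zero_comp, zero_add,
      Category.assoc, reassoc_of% hc.ι, reassoc_of% h2, ← hc'.ι, Category.assoc, hn,
      Preadditive.comp_sub, compι_snd, reassoc_of% @compι_fst]
    simp
  · have hnσ : n ≫ Q.σ = (comp (ofHom f) Q).σ ≫ f.right := by
      rw [← cancel_epi (compπ (ofHom f) Q), reassoc_of% hn, reassoc_of% hc'.σ,
        Preadditive.sub_comp, ← pullback.condition]
      simp only [Category.assoc, Q.κ_σ, ← Preadditive.comp_sub]
      congr 1
      apply biprod.hom_ext' <;> simp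
    simp only [Category.assoc]
    rw [hnσ, reassoc_of% h3, reassoc_of% hc.σ, reassoc_of% hm1]
  · have hnρ : n ≫ Q.ρ = (comp (ofHom f) Q).ρ := by
      rw [← cancel_epi (compπ (ofHom f) Q), reassoc_of% hn, hc'.ρ, Preadditive.sub_comp]
      simp [Q.κ_ρ]
    simp only [Category.assoc]
    rw [hnρ, h4, hc.ρ, reassoc_of% hm2]
    simp

/-- The vanishing principle behind the uniqueness of links and of induced maps. -/
lemma eq_zero_of_torsion (t : TorsionPair A) {P : Butterfly X Y} {Q : Butterfly Z W}
    (hX : t.T (cokernel X.hom)) (hW : t.F (kernel W.hom)) (h : P.E ⟶ Q.E)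
    (h1 : P.κ ≫ h = 0) (h2 : P.ι ≫ h = 0) (h3 : h ≫ Q.σ = 0) (h4 : h ≫ Q.ρ = 0) : h = 0 := by
  obtain ⟨a, ha⟩ : ∃ a, P.σ ≫ a = h := ⟨P.exact.exact.desc h h2, P.exact.exact.g_desc h h2⟩
  have ha' : X.hom ≫ a = 0 := by rw [← P.κ_σ, Category.assoc, ha, h1]
  obtain ⟨b, hb⟩ : ∃ b, cokernel.π X.hom ≫ b = a := ⟨cokernel.desc _ a ha', cokernel.π_desc _ _ _⟩
  have hb' : b ≫ Q.σ = 0 := by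
    rw [← cancel_epi (cokernel.π X.hom), ← cancel_epi P.σ, reassoc_of% hb, reassoc_of% ha, h3]
    simp
  obtain ⟨c, hc⟩ : ∃ c, c ≫ Q.ι = b := ⟨Q.exact.exact.lift b hb', Q.exact.exact.lift_f b hb'⟩
  have hc' : c ≫ W.hom = 0 := by
    rw [← Q.ι_ρ, reassoc_of% hc, ← cancel_epi (cokernel.π X.hom), ← cancel_epi P.σ,
      reassoc_of% hb, reassoc_of% ha, h4]
    simp
  have hc0 : c = 0 := by
    rw [← kernel.lift_ι W.hom c hc', t.hom_eq_zero hX hW (kernel.lift W.hom c hc'), zero_comp]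
  rw [← ha, ← hb, ← hc, hc0]
  simp

end Butterfly

/-! ### The tilted category -/

/-- Objects of the tilted category `B`: two-term complexes `[X⁻¹ ⟶ X⁰]` whose kernel is in `ℱ`
and whose cokernel is in `𝒯`. -/
structure Tilt (t : TorsionPair A) where
  arrow : Arrow A
  ker_mem : t.F (kernel arrow.hom)
  coker_mem : t.T (cokernel arrow.hom)

namespace Tilt

variable {t : TorsionPair A}

/-- The tilted category `B`: morphisms are isomorphism classes of butterflies. -/
instance : Category.{max u v} (Tilt t) where
  Hom X Y := Quotient (Butterfly.setoid X.arrow Y.arrow)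
  id X := ⟦Butterfly.ofHom (𝟙 X.arrow)⟧
  comp := Quotient.map₂ Butterfly.comp fun _ _ h _ _ h' => Butterfly.comp_congr h h'
  id_comp := by
    rintro X Y ⟨P⟩
    exact Quotient.sound (Butterfly.id_comp P)
  comp_id := by
    rintro X Y ⟨P⟩
    exact Quotient.sound (Butterfly.comp_id P)
  assoc := by
    rintro X Y Z W ⟨P⟩ ⟨Q⟩ ⟨R⟩
    exact Quotient.sound (Butterfly.assoc P Q R)

/-- The morphism of `B` represented by a butterfly. -/
def ofB {X Y : Tilt t} (P : Butterfly X.arrow Y.arrow) : X ⟶ Y := Quotient.mk _ P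

/-- A representative of a morphism of `B`. -/
def out {X Y : Tilt t} (f : X ⟶ Y) : Butterfly X.arrow Y.arrow := Quotient.out f

lemma ofB_out {X Y : Tilt t} (f : X ⟶ Y) : ofB (out f) = f := Quotient.out_eq f

lemma ofB_comp {X Y Z : Tilt t} (P : Butterfly X.arrow Y.arrow) (Q : Butterfly Y.arrow Z.arrow) :
    ofB P ≫ ofB Q = ofB (P.comp Q) := rfl

lemma ofB_eq_iff {X Y : Tilt t} (P Q : Butterfly X.arrow Y.arrow) : ofB P = ofB Q ↔ P ≈ Q :=
  Quotient.eq

/-- The strict morphism of `B` given by a morphism of two-term complexes. -/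
def strict {X Y : Tilt t} (f : X.arrow ⟶ Y.arrow) : X ⟶ Y := ofB (Butterfly.ofHom f)

lemma strict_id (X : Tilt t) : strict (𝟙 X.arrow) = 𝟙 X := rfl

lemma strict_comp {X Y Z : Tilt t} (f : X.arrow ⟶ Y.arrow) (g : Y.arrow ⟶ Z.arrow) :
    strict (f ≫ g) = strict f ≫ strict g :=
  (Quotient.sound (Butterfly.ofHom_comp_ofHom f g)).symm

instance : HasZeroMorphisms (Tilt t) where
  zero X Y := ⟨strict (Butterfly.zeroHom X.arrow Y.arrow)⟩
  comp_zero := by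
    rintro X Y ⟨P⟩ Z
    exact Quotient.sound (Butterfly.comp_zero' P)
  zero_comp := by
    rintro X Y Z ⟨P⟩
    exact Quotient.sound (Butterfly.zero_comp' P)

lemma zero_def (X Y : Tilt t) :
    (0 : X ⟶ Y) = ofB (Butterfly.ofHom (Butterfly.zeroHom X.arrow Y.arrow)) := rfl

end Tilt

/-! ### Complexes in `B` and strict morphisms -/

/-- Objects of `Ch^st(B)`: cochain complexes in `B`. -/
structure ChSt (t : TorsionPair A) where
  cx : CochainComplex (Tilt t) ℤ

namespace ChSt

variable {t : TorsionPair A}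

/-- Morphisms of `Ch^st(B)`: a family of morphisms of two-term complexes such that the
associated strict morphisms of `B` form a morphism of complexes in `B`. -/
@[ext]
structure Hom (X Y : ChSt t) where
  f : ∀ n : ℤ, (X.cx.X n).arrow ⟶ (Y.cx.X n).arrow
  comm : ∀ i j : ℤ, Tilt.strict (f i) ≫ Y.cx.d i j = X.cx.d i j ≫ Tilt.strict (f j)

instance : Category (ChSt t) where
  Hom := Hom
  id X := ⟨fun _ => 𝟙 _, fun i j => by
    rw [Tilt.strict_id, Tilt.strict_id, Category.id_comp, Category.comp_id]⟩
  comp φ ψ := ⟨fun n => φ.f n ≫ ψ.f n, fun i j => by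
    rw [Tilt.strict_comp, Tilt.strict_comp, Category.assoc, ψ.comm, ← Category.assoc, φ.comm,
      Category.assoc]⟩
  id_comp _ := Hom.ext (by funext n; exact Category.id_comp _)
  comp_id _ := Hom.ext (by funext n; exact Category.comp_id _)
  assoc _ _ _ := Hom.ext (by funext n; exact Category.assoc _ _ _)

/-- The functor `Ch^st(B) ⥤ Ch(B)`. -/
def toCh (t : TorsionPair A) : ChSt t ⥤ CochainComplex (Tilt t) ℤ where
  obj X := X.cx
  map φ := { f := fun n => Tilt.strict (φ.f n), comm' := fun i j _ => φ.comm i j }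
  map_id X := by ext n; exact Tilt.strict_id _
  map_comp φ ψ := by ext n; exact Tilt.strict_comp (ChSt.Hom.f φ n) (ChSt.Hom.f ψ n)

/-- Strict morphisms of complexes that become isomorphisms in `Ch(B)`. -/
def sis (t : TorsionPair A) : MorphismProperty (ChSt t) := fun _ _ φ => IsIso ((toCh t).map φ)

/-- Strict morphisms of complexes that are quasi-isomorphisms in `Ch(B)`. The existence of the
cohomology objects in `B` is not presupposed but part of the condition. -/
def qis (t : TorsionPair A) : MorphismProperty (ChSt t) := fun X Y φ =>
  ∀ n : ℤ, ∃ (_ : ((toCh t).obj X).HasHomology n) (_ : ((toCh t).obj Y).HasHomology n),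
    QuasiIsoAt ((toCh t).map φ) n

end ChSt

/-! ### Decorated complexes -/

variable (A) in
/-- A decorated complex: a complex `E` with a subobject `M n` of each `E n`, not necessarily
respected by the differential. -/
structure Dec where
  cx : CochainComplex A ℤ
  M : ∀ n : ℤ, Subobject (cx.X n)

namespace Dec

/-- Morphisms of decorated complexes: chain maps `φ` with `φ (M n) ⊆ N n`. -/
@[ext]
structure Hom (E F : Dec A) where
  φ : E.cx ⟶ F.cx
  factors : ∀ n : ℤ, (F.M n).Factors ((E.M n).arrow ≫ φ.f n)

instance : Category (Dec A) where
  Hom := Hom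
  id E := ⟨𝟙 _, fun n => by
    rw [HomologicalComplex.id_f, Category.comp_id]
    exact (E.M n).factors_self⟩
  comp {E F G} α β := ⟨α.φ ≫ β.φ, fun n => by
    rw [HomologicalComplex.comp_f, ← Category.assoc, ← Subobject.factorThru_arrow _ _ (α.factors n),
      Category.assoc]
    exact Subobject.factors_of_factors_right _ (β.factors n)⟩
  id_comp _ := Hom.ext (Category.id_comp _)
  comp_id _ := Hom.ext (Category.comp_id _)
  assoc _ _ _ := Hom.ext (Category.assoc _ _ _)

/-- The map `M i ⟶ E j / M j` induced by the differential `E i ⟶ E j`. -/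
def dbar (E : Dec A) (i j : ℤ) : (E.M i : A) ⟶ cokernel (E.M j).arrow :=
  (E.M i).arrow ≫ E.cx.d i j ≫ cokernel.π (E.M j).arrow

/-- `H^{-1,n}(E, M)`. -/
def Hm1 (E : Dec A) (n : ℤ) : A := kernel (E.dbar n (n + 1))

/-- `H^{0,n}(E, M)`. -/
def H0 (E : Dec A) (n : ℤ) : A := cokernel (E.dbar n (n + 1))

/-- The induced map `M n ⟶ N n`. -/
def mapM {E F : Dec A} (α : E ⟶ F) (n : ℤ) : (E.M n : A) ⟶ (F.M n : A) :=
  (F.M n).factorThru ((E.M n).arrow ≫ (Hom.φ α).f n) (Hom.factors α n)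

lemma mapM_arrow {E F : Dec A} (α : E ⟶ F) (n : ℤ) :
    mapM α n ≫ (F.M n).arrow = (E.M n).arrow ≫ (Hom.φ α).f n :=
  Subobject.factorThru_arrow _ _ _

/-- The induced map `E n / M n ⟶ F n / N n`. -/
def mapQ {E F : Dec A} (α : E ⟶ F) (n : ℤ) :
    cokernel (E.M n).arrow ⟶ cokernel (F.M n).arrow :=
  cokernel.map _ _ (mapM α n) ((Hom.φ α).f n) (mapM_arrow α n).symm

lemma dbar_comm {E F : Dec A} (α : E ⟶ F) (i j : ℤ) :
    E.dbar i j ≫ mapQ α j = mapM α i ≫ F.dbar i j := by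
  simp only [dbar, mapQ, Category.assoc, cokernel.π_desc]
  rw [← Category.assoc (mapM α i), mapM_arrow]
  simp

/-- The induced map on `H^{-1,n}`. -/
def mapHm1 {E F : Dec A} (α : E ⟶ F) (n : ℤ) : E.Hm1 n ⟶ F.Hm1 n :=
  kernel.map _ _ (mapM α n) (mapQ α (n + 1)) (dbar_comm α n (n + 1))

/-- The induced map on `H^{0,n}`. -/
def mapH0 {E F : Dec A} (α : E ⟶ F) (n : ℤ) : E.H0 n ⟶ F.H0 n :=
  cokernel.map _ _ (mapM α n) (mapQ α (n + 1)) (dbar_comm α n (n + 1))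

/-- Compatibility of the decoration with a torsion pair. -/
def compatible (t : TorsionPair A) : ObjectProperty (Dec A) := fun E =>
  ∀ n : ℤ, t.F (E.Hm1 n) ∧ t.T (E.H0 n)

/-- The reindexing `(E, M) ↦ (E', M')` with `E' n = E (n - 1)`, `M' n = M (n - 1)` and unchanged
differentials. -/
def reindex : Dec A ⥤ Dec A where
  obj E :=
    { cx :=
        { X := fun n => E.cx.X (n - 1)
          d := fun i j => E.cx.d (i - 1) (j - 1)
          shape := fun i j hij => E.cx.shape _ _ fun h => hij (by
            simp only [ComplexShape.up_Rel] at h ⊢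
            omega)
          d_comp_d' := fun _ _ _ _ _ => E.cx.d_comp_d _ _ _ }
      M := fun n => E.M (n - 1) }
  map α :=
    { φ :=
        { f := fun n => (Hom.φ α).f (n - 1)
          comm' := fun i j _ => (Hom.φ α).comm (i - 1) (j - 1) }
      factors := fun n => Hom.factors α (n - 1) }
  map_id _ := rfl
  map_comp _ _ := rfl

end Dec

/-- `Ch(A, 𝒯, ℱ)`: the full subcategory of decorated complexes whose decoration is compatible
with the torsion pair. -/
abbrev ChDec (t : TorsionPair A) := (Dec.compatible t).FullSubcategory

namespace ChDec

/-- Morphisms inducing isomorphisms on all `H^{-1,n}` and `H^{0,n}`. -/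
def sis (t : TorsionPair A) : MorphismProperty (ChDec t) := fun _ _ α =>
  ∀ n : ℤ, IsIso (Dec.mapHm1 α.hom n) ∧ IsIso (Dec.mapH0 α.hom n)

/-- Morphisms inducing isomorphisms on the usual cohomology. -/
def qis (t : TorsionPair A) : MorphismProperty (ChDec t) := fun _ _ α =>
  QuasiIso (Dec.Hom.φ α.hom)

end ChDec

/-! ### The functor `Tot` -/

namespace Tot

variable {t : TorsionPair A}

/-- A butterfly representing the differential from degree `n` to degree `n + 1`. -/
def rep (X : ChSt t) (n : ℤ) : Butterfly (X.cx.X n).arrow (X.cx.X (n + 1)).arrow :=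
  Tilt.out (X.cx.d n (n + 1))

lemma exists_link (X : ChSt t) (n : ℤ) : ∃ δ : (rep X n).E ⟶ (rep X (n + 1)).E,
    (rep X n).κ ≫ δ = 0 ∧ (rep X n).ι ≫ δ = (rep X (n + 1)).κ ∧
      δ ≫ (rep X (n + 1)).σ = (rep X n).ρ ∧ δ ≫ (rep X (n + 1)).ρ = 0 := by
  apply Butterfly.exists_link
  rw [← Tilt.ofB_eq_iff, ← Tilt.ofB_comp, rep, rep, Tilt.ofB_out, Tilt.ofB_out, ← Tilt.zero_def,
    X.cx.d_comp_d]

/-- The (unique) link between two consecutive differentials. -/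
def δ (X : ChSt t) (n : ℤ) : (rep X n).E ⟶ (rep X (n + 1)).E := (exists_link X n).choose

lemma κ_δ (X : ChSt t) (n : ℤ) : (rep X n).κ ≫ δ X n = 0 := (exists_link X n).choose_spec.1

lemma ι_δ (X : ChSt t) (n : ℤ) : (rep X n).ι ≫ δ X n = (rep X (n + 1)).κ :=
  (exists_link X n).choose_spec.2.1

lemma δ_σ (X : ChSt t) (n : ℤ) : δ X n ≫ (rep X (n + 1)).σ = (rep X n).ρ :=
  (exists_link X n).choose_spec.2.2.1

lemma δ_ρ (X : ChSt t) (n : ℤ) : δ X n ≫ (rep X (n + 1)).ρ = 0 :=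
  (exists_link X n).choose_spec.2.2.2

lemma δ_δ (X : ChSt t) (n : ℤ) : δ X n ≫ δ X (n + 1) = 0 := by
  refine Butterfly.eq_zero_of_torsion t (X.cx.X n).coker_mem (X.cx.X _).ker_mem _ ?_ ?_ ?_ ?_
  · rw [reassoc_of% κ_δ, zero_comp]
  · rw [reassoc_of% ι_δ, κ_δ]
  · rw [Category.assoc, δ_σ, δ_ρ]
  · rw [Category.assoc, δ_ρ, comp_zero]

lemma exists_map {X Y : ChSt t} (φ : X ⟶ Y) (n : ℤ) : ∃ g : (rep X n).E ⟶ (rep Y n).E,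
    (rep X n).κ ≫ g = (ChSt.Hom.f φ n).left ≫ (rep Y n).κ ∧
    (rep X n).ι ≫ g = (ChSt.Hom.f φ (n + 1)).left ≫ (rep Y n).ι ∧
    g ≫ (rep Y n).σ = (rep X n).σ ≫ (ChSt.Hom.f φ n).right ∧
    g ≫ (rep Y n).ρ = (rep X n).ρ ≫ (ChSt.Hom.f φ (n + 1)).right := by
  apply Butterfly.exists_map
  rw [← Tilt.ofB_eq_iff, ← Tilt.ofB_comp, ← Tilt.ofB_comp, rep, rep, Tilt.ofB_out, Tilt.ofB_out]
  exact (ChSt.Hom.comm φ n (n + 1)).symm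

/-- The (unique) map of middle objects induced by a strict morphism of complexes. -/
def map {X Y : ChSt t} (φ : X ⟶ Y) (n : ℤ) : (rep X n).E ⟶ (rep Y n).E :=
  (exists_map φ n).choose

section

variable {X Y Z : ChSt t} (φ : X ⟶ Y) (ψ : Y ⟶ Z) (n : ℤ)

lemma κ_map : (rep X n).κ ≫ map φ n = (ChSt.Hom.f φ n).left ≫ (rep Y n).κ :=
  (exists_map φ n).choose_spec.1

lemma ι_map : (rep X n).ι ≫ map φ n = (ChSt.Hom.f φ (n + 1)).left ≫ (rep Y n).ι :=
  (exists_map φ n).choose_spec.2.1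

lemma map_σ : map φ n ≫ (rep Y n).σ = (rep X n).σ ≫ (ChSt.Hom.f φ n).right :=
  (exists_map φ n).choose_spec.2.2.1

lemma map_ρ : map φ n ≫ (rep Y n).ρ = (rep X n).ρ ≫ (ChSt.Hom.f φ (n + 1)).right :=
  (exists_map φ n).choose_spec.2.2.2

lemma map_ext {g g' : (rep X n).E ⟶ (rep Y n).E} (h1 : (rep X n).κ ≫ g = (rep X n).κ ≫ g')
    (h2 : (rep X n).ι ≫ g = (rep X n).ι ≫ g') (h3 : g ≫ (rep Y n).σ = g' ≫ (rep Y n).σ)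
    (h4 : g ≫ (rep Y n).ρ = g' ≫ (rep Y n).ρ) : g = g' := by
  rw [← sub_eq_zero]
  refine Butterfly.eq_zero_of_torsion t (X.cx.X n).coker_mem (Y.cx.X _).ker_mem _ ?_ ?_ ?_ ?_
  · rw [Preadditive.comp_sub, h1, sub_self]
  · rw [Preadditive.comp_sub, h2, sub_self]
  · rw [Preadditive.sub_comp, h3, sub_self]
  · rw [Preadditive.sub_comp, h4, sub_self]

lemma map_δ : map φ n ≫ δ Y n = δ X n ≫ map φ (n + 1) := by
  rw [← sub_eq_zero]
  refine Butterfly.eq_zero_of_torsion t (X.cx.X n).coker_mem (Y.cx.X _).ker_mem _ ?_ ?_ ?_ ?_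
  · rw [Preadditive.comp_sub, reassoc_of% κ_map, κ_δ, reassoc_of% κ_δ, comp_zero, zero_comp,
      sub_zero]
  · rw [Preadditive.comp_sub, reassoc_of% ι_map, ι_δ, reassoc_of% ι_δ, κ_map, sub_self]
  · rw [Preadditive.sub_comp, Category.assoc, Category.assoc, δ_σ, map_ρ, map_σ,
      reassoc_of% δ_σ, sub_self]
  · rw [Preadditive.sub_comp, Category.assoc, Category.assoc, δ_ρ, map_ρ, reassoc_of% δ_ρ,
      comp_zero, zero_comp, sub_zero]

lemma factors_map :
    (Subobject.mk (rep Y n).ι).Factors ((Subobject.mk (rep X n).ι).arrow ≫ map φ n) := by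
  have h : ((Subobject.underlyingIso (rep X n).ι).hom ≫ (ChSt.Hom.f φ (n + 1)).left) ≫
      (rep Y n).ι = (Subobject.mk (rep X n).ι).arrow ≫ map φ n := by
    rw [Category.assoc, ← ι_map, Subobject.underlyingIso_hom_comp_eq_mk_assoc]
  exact (Subobject.mk_factors_iff _ _).2 ⟨_, h⟩

lemma map_id : map (𝟙 X) n = 𝟙 _ := by
  apply map_ext
  · rw [κ_map, Category.comp_id]; exact Category.id_comp _
  · rw [ι_map, Category.comp_id]; exact Category.id_comp _
  · rw [map_σ, Category.id_comp]; exact Category.comp_id _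
  · rw [map_ρ, Category.id_comp]; exact Category.comp_id _

lemma map_comp : map (φ ≫ ψ) n = map φ n ≫ map ψ n := by
  apply map_ext
  · rw [κ_map, reassoc_of% κ_map, κ_map, ← Category.assoc]; rfl
  · rw [ι_map, reassoc_of% ι_map, ι_map, ← Category.assoc]; rfl
  · rw [map_σ, Category.assoc, map_σ, reassoc_of% map_σ]; rfl
  · rw [map_ρ, Category.assoc, map_ρ, reassoc_of% map_ρ]; rfl

end

/-- The decorated complex with terms `(E n, ι (X^{n+1})⁻¹)`, where `E n` is the middle object of
the differential from degree `n` to degree `n + 1`, and with the links as differentials. -/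
def auxObj (X : ChSt t) : Dec A where
  cx := CochainComplex.of (fun n => (rep X n).E) (δ X) (δ_δ X)
  M := fun n => Subobject.mk (rep X n).ι

lemma auxObj_d (X : ChSt t) (n : ℤ) : (auxObj X).cx.d n (n + 1) = δ X n :=
  CochainComplex.of_d (fun n => (rep X n).E) (δ X) n

/-- The functor given by `Tot.auxObj`. -/
def aux (t : TorsionPair A) : ChSt t ⥤ Dec A where
  obj X := auxObj X
  map {X Y} φ :=
    { φ :=
        { f := map φ
          comm' := by
            rintro i _ rfl
            rw [auxObj_d, auxObj_d]
            exact map_δ φ i }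
      factors := factors_map φ }
  map_id X := Dec.Hom.ext (by ext n; exact map_id n)
  map_comp φ ψ := Dec.Hom.ext (by ext n; exact map_comp φ ψ n)

lemma ι_quot {X Y : Arrow A} (P : Butterfly X Y) :
    P.ι ≫ cokernel.π (Subobject.mk P.ι).arrow = 0 := by
  rw [← cancel_epi (Subobject.underlyingIso P.ι).hom,
    Subobject.underlyingIso_hom_comp_eq_mk_assoc, cokernel.condition, comp_zero]

/-- The middle object of a butterfly modulo the image of `ι`. -/
def quotIso {X Y : Arrow A} (P : Butterfly X Y) :
    cokernel (Subobject.mk P.ι).arrow ≅ X.right where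
  hom := cokernel.desc _ P.σ (by
    rw [← Subobject.underlyingIso_hom_comp_eq_mk, Category.assoc, P.ι_σ, comp_zero])
  inv := P.exact.exact.desc (cokernel.π _) (ι_quot P)
  hom_inv_id := by
    rw [← cancel_epi (cokernel.π _), cokernel.π_desc_assoc, Category.comp_id]
    exact P.exact.exact.g_desc _ _
  inv_hom_id := by
    rw [← cancel_epi P.σ, Category.comp_id]
    have h := P.exact.exact.g_desc (cokernel.π (Subobject.mk P.ι).arrow) (ι_quot P)
    rw [← Category.assoc]
    refine (congrArg (· ≫ _) h).trans ?_
    simp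

lemma dbar_auxObj (X : ChSt t) (i : ℤ) :
    (auxObj X).dbar i (i + 1) ≫ (quotIso (rep X (i + 1))).hom =
      (Subobject.underlyingIso (rep X i).ι).hom ≫ (X.cx.X (i + 1)).arrow.hom := by
  rw [Dec.dbar, auxObj_d]
  change ((Subobject.mk (rep X i).ι).arrow ≫ δ X i ≫ cokernel.π (Subobject.mk _).arrow) ≫
    cokernel.desc _ _ _ = _
  simp only [Category.assoc, cokernel.π_desc]
  rw [δ_σ, ← Butterfly.ι_ρ (rep X i), Subobject.underlyingIso_hom_comp_eq_mk_assoc]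

lemma ker_dbar_mem (X : ChSt t) (i j : ℤ) (h : j = i + 1) :
    t.F (kernel ((auxObj X).dbar i j)) ∧ t.T (cokernel ((auxObj X).dbar i j)) := by
  subst h
  have := t.F_iso
  have := t.T_iso
  exact ⟨t.F.prop_of_iso (kernel.mapIso _ _ _ _ (dbar_auxObj X i)).symm (X.cx.X (i + 1)).ker_mem,
    t.T.prop_of_iso (cokernel.mapIso _ _ _ _ (dbar_auxObj X i)).symm (X.cx.X (i + 1)).coker_mem⟩

end Tot

/-- The functor `Tot : Ch^st(B) ⥤ Ch(A, 𝒯, ℱ)`: the term of `Tot X` in degree `n` is the middle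
object of a butterfly representing the differential of `X` from degree `n - 1` to degree `n`, its
decoration in degree `n` is the image of `ι : (X^n)⁻¹ ⟶ E^n`, and its differentials are the
links. -/
def Tot (t : TorsionPair A) : ChSt t ⥤ ChDec t :=
  (Dec.compatible t).lift (Tot.aux t ⋙ Dec.reindex) fun X n =>
    Tot.ker_dbar_mem X (n - 1) (n + 1 - 1) (by omega)

end HRSTilt

end

/-
The middle object `E` of a butterfly `P : 𝕏 ⟶ 𝕐` has a *cut* `im κ ⊆ W ⊆ ker ρ`: the inverse image
of the torsion part of `ker ρ / im κ`. Then `[X⁻¹ ⟶ W]` is a kernel and `[E / W ⟶ Y⁰]` a cokernel of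
`P` in `B`, and the cohomology in `B` of a complex is represented by the maps
`E (n - 1) / W (n - 1) ⟶ W n` induced by the links. The cuts also present the cohomology of the
total complex as an extension of a torsion-free by a torsion object, namely of the kernel in `A` of
one of these maps by the cokernel of the preceding one. Such extensions are functorial, and a strict
morphism is invertible in `B` iff it induces isomorphisms on the kernels and cokernels in `A` of the
two-term complexes, so quasi-isomorphisms correspond. Strict isomorphisms correspond because
`ⁿ𝕏 ≅ [M n ⟶ E (n + 1) / M (n + 1)]` for `M` the decoration. The latter two-term complexes and the
butterflies between them with middle objects `E (n + 1)` define the quasi-inverse.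
-/

noncomputable section

namespace HRSTilt

variable {A : Type u} [Category.{v} A] [Abelian A]

namespace TorsionPair

variable (t : TorsionPair A)

lemma T_of_hom_eq_zero {X : A} (h : ∀ {Y : A}, t.F Y → ∀ f : X ⟶ Y, f = 0) : t.T X := by
  obtain ⟨S, hS, rfl, hT, hF⟩ := t.exists_shortExact X
  have := t.T_iso
  have := hS.mono_f
  have : Epi S.f := hS.exact.epi_f (h hF _)
  have : IsIso S.f := isIso_of_mono_of_epi _
  exact t.T.prop_of_iso (asIso S.f) hT

lemma F_of_hom_eq_zero {Y : A} (h : ∀ {X : A}, t.T X → ∀ f : X ⟶ Y, f = 0) : t.F Y := by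
  obtain ⟨S, hS, rfl, hT, hF⟩ := t.exists_shortExact Y
  have := t.F_iso
  have := hS.epi_g
  have : Mono S.g := hS.exact.mono_g (h hT _)
  have : IsIso S.g := isIso_of_mono_of_epi _
  exact t.F.prop_of_iso (asIso S.g).symm hF

lemma T_of_epi {X Y : A} (f : X ⟶ Y) [Epi f] (hX : t.T X) : t.T Y :=
  t.T_of_hom_eq_zero fun hZ g => by
    rw [← cancel_epi f, t.hom_eq_zero hX hZ (f ≫ g), comp_zero]

lemma F_of_mono {X Y : A} (f : X ⟶ Y) [Mono f] (hY : t.F Y) : t.F X :=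
  t.F_of_hom_eq_zero fun hZ g => by
    rw [← cancel_mono f, t.hom_eq_zero hZ hY (g ≫ f), zero_comp]

lemma F_kernel_of_comp {X Y Z : A} {f : X ⟶ Y} {g : Y ⟶ Z} {h : X ⟶ Z} (w : f ≫ g = h)
    (hh : t.F (kernel h)) : t.F (kernel f) := by
  have h0 : kernel.ι f ≫ h = 0 := by rw [← w, kernel.condition_assoc, zero_comp]
  have : Mono (kernel.lift h _ h0) := mono_of_mono_fac (kernel.lift_ι h _ h0)
  exact t.F_of_mono (kernel.lift h _ h0) hh

lemma T_cokernel_of_comp {X Y Z : A} {f : X ⟶ Y} {g : Y ⟶ Z} {h : X ⟶ Z} (w : f ≫ g = h)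
    (hh : t.T (cokernel h)) : t.T (cokernel g) := by
  have h0 : h ≫ cokernel.π g = 0 := by rw [← w, Category.assoc, cokernel.condition, comp_zero]
  have : Epi (cokernel.desc h _ h0) := epi_of_epi_fac (cokernel.π_desc h _ h0)
  exact t.T_of_epi (cokernel.desc h _ h0) hh

lemma T_cokernel_of_exact {X Y Z : A} {f : X ⟶ Y} {g : Y ⟶ Z} {w : f ≫ g = 0}
    (h : (ShortComplex.mk f g w).Exact) [Epi g] (hZ : t.T Z) : t.T (cokernel f) := by
  have := t.T_iso
  have : Epi (ShortComplex.mk f g w).g := ‹Epi g›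
  exact t.T.prop_of_iso (h.gIsCokernel.coconePointUniqueUpToIso (colimit.isColimit _)) hZ

lemma F_kernel_of_exact {X Y Z : A} {f : X ⟶ Y} {g : Y ⟶ Z} {w : f ≫ g = 0}
    (h : (ShortComplex.mk f g w).Exact) [Mono f] (hX : t.F X) : t.F (kernel g) := by
  have := t.F_iso
  have : Mono (ShortComplex.mk f g w).f := ‹Mono f›
  exact t.F.prop_of_iso (h.fIsKernel.conePointUniqueUpToIso (limit.isLimit _)) hX

lemma eq_zero_of_comp_eq_zero {U W C V : A} {k : U ⟶ W} {c : C ⟶ V} (hk : t.T (cokernel k))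
    (hc : t.F (kernel c)) (x : W ⟶ C) (h₁ : k ≫ x = 0) (h₂ : x ≫ c = 0) : x = 0 := by
  have h : cokernel.desc k x h₁ ≫ c = 0 := by
    rw [← cancel_epi (cokernel.π k), cokernel.π_desc_assoc, h₂, comp_zero]
  have h0 := t.hom_eq_zero hk hc (kernel.lift c _ h)
  rw [← cokernel.π_desc k x h₁, ← kernel.lift_ι c _ h, h0, zero_comp, comp_zero]

end TorsionPair

lemma isPullback_of_shortExact {X₁ X₂ X₃ X₄ : A} {f : X₁ ⟶ X₂} {g : X₁ ⟶ X₃} {inl : X₂ ⟶ X₄}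
    {inr : X₃ ⟶ X₄} (sq : CommSq f g inl inr) (h : sq.shortComplex.ShortExact) :
    IsPullback f g inl inr := by
  have : Mono (biprod.lift f (-g)) := h.mono_f
  have : Mono sq.shortComplex.f := h.mono_f
  have hlift (s : PullbackCone inl inr) : ∃ z : s.pt ⟶ X₁, z ≫ f = s.fst ∧ z ≫ g = s.snd := by
    obtain ⟨z, hz⟩ : ∃ z : s.pt ⟶ X₁, z ≫ biprod.lift f (-g) = biprod.lift s.fst (-s.snd) :=
      have w : biprod.lift s.fst (-s.snd) ≫ biprod.desc inl inr = 0 := by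
        simp [biprod.lift_desc, s.condition]
      ⟨h.exact.lift _ w, h.exact.lift_f _ w⟩
    exact ⟨z, by simpa using hz =≫ biprod.fst, by simpa using hz =≫ biprod.snd⟩
  choose lift fst snd using hlift
  refine ⟨sq, ⟨PullbackCone.IsLimit.mk _ lift fst snd fun s m h₁ h₂ => ?_⟩⟩
  rw [← cancel_mono (biprod.lift f (-g))]
  apply biprod.hom_ext <;> simp [h₁, h₂, fst, snd]

/-- For `a : U ⟶ E` and `b : E ⟶ V`, a subobject `W` of `E`, with quotient `C`, that contains the
image of `a` with torsion quotient and is contained in the kernel of `b` with torsion-free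
quotient. For the diagonals of a butterfly, `k : U ⟶ W` and `c : C ⟶ V` are its kernel and its
cokernel in the tilted category. -/
structure Cut (t : TorsionPair A) {U E V : A} (a : U ⟶ E) (b : E ⟶ V) where
  W : A
  C : A
  k : U ⟶ W
  w : W ⟶ E
  p : E ⟶ C
  c : C ⟶ V
  w_p : w ≫ p = 0
  exact : (ShortComplex.mk w p w_p).ShortExact
  k_w : k ≫ w = a
  p_c : p ≫ c = b
  T_mem : t.T (cokernel k)
  F_mem : t.F (kernel c)

namespace Cut

section Existence

variable (S : ShortComplex A) {T F : A} (i : T ⟶ S.homology) (q : S.homology ⟶ F)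

lemma exact_lift_toCycles_fst :
    (ShortComplex.mk (pullback.lift 0 S.toCycles (by simp)) (pullback.fst i S.homologyπ)
      (pullback.lift_fst _ _ _)).Exact := by
  rw [ShortComplex.exact_iff_exact_up_to_refinements]
  intro R z (hz : z ≫ pullback.fst i S.homologyπ = 0)
  have hcyc : (ShortComplex.mk S.toCycles S.homologyπ (by simp)).Exact :=
    ShortComplex.exact_of_g_is_cokernel _ S.homologyIsCokernel
  obtain ⟨R', π, hπ, y, hy⟩ := hcyc.exact_up_to_refinements (z ≫ pullback.snd i S.homologyπ)
    (by simp [← pullback.condition, reassoc_of% hz])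
  refine ⟨R', π, hπ, y, pullback.hom_ext ?_ ?_⟩
  · simp only [Category.assoc, hz, pullback.lift_fst, comp_zero]
  · simpa only [Category.assoc, pullback.lift_snd] using hy

lemma exact_inl_desc_fromOpcycles [Epi q] :
    (ShortComplex.mk (pushout.inl q S.homologyι) (pushout.desc 0 S.fromOpcycles (by simp))
      (pushout.inl_desc _ _ _)).Exact := by
  have hop : (ShortComplex.mk S.homologyι S.fromOpcycles (by simp)).Exact :=
    ShortComplex.exact_of_f_is_kernel _ S.homologyIsKernel
  rw [ShortComplex.exact_iff_exact_up_to_refinements]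
  intro R z (hz : z ≫ pushout.desc 0 S.fromOpcycles _ = 0)
  obtain ⟨R', π, hπ, y, hy⟩ :=
    surjective_up_to_refinements_of_epi (pushout.inr q S.homologyι) z
  have hy' : y ≫ S.fromOpcycles = 0 := by
    rw [← pushout.inr_desc (f := q) (g := S.homologyι) 0 S.fromOpcycles (by simp),
      ← reassoc_of% hy, hz, comp_zero]
  refine ⟨R', π, hπ, hop.lift y hy' ≫ q, ?_⟩
  rw [hy, Category.assoc, pushout.condition, ← Category.assoc]
  exact congrArg (· ≫ _) (hop.lift_f y hy').symm

lemma shortExact_iCycles_pOpcycles {hiq : i ≫ q = 0} (hS : (ShortComplex.mk i q hiq).ShortExact) :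
    (ShortComplex.mk (pullback.snd i S.homologyπ ≫ S.iCycles)
      (S.pOpcycles ≫ pushout.inr q S.homologyι) (by
        rw [Category.assoc, ← S.homology_π_ι_assoc, ← pullback.condition_assoc,
          ← pushout.condition, reassoc_of% hiq, zero_comp, comp_zero])).ShortExact := by
  have : Mono i := hS.mono_f
  have : Epi q := hS.epi_g
  have hpush := IsPushout.of_hasPushout q S.homologyι
  have hmono : Mono (biprod.lift q (-S.homologyι)) :=
    mono_of_mono_fac (biprod.lift_snd q (-S.homologyι))
  have hpull := isPullback_of_shortExact hpush.toCommSq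
    { exact := hpush.exact_shortComplex, mono_f := hmono, epi_g := hpush.epi_shortComplex_g }
  refine { exact := ?_, mono_f := mono_comp _ _, epi_g := epi_comp _ _ }
  rw [ShortComplex.exact_iff_exact_up_to_refinements]
  intro R z (hz : z ≫ S.pOpcycles ≫ pushout.inr q S.homologyι = 0)
  obtain ⟨y, hyq, hy⟩ : ∃ y : R ⟶ S.homology, y ≫ q = 0 ∧ y ≫ S.homologyι = z ≫ S.pOpcycles :=
    ⟨hpull.lift 0 (z ≫ S.pOpcycles) (by simp [hz]), hpull.lift_fst _ _ _, hpull.lift_snd _ _ _⟩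
  have hzg : z ≫ S.g = 0 := by
    rw [← S.p_fromOpcycles, ← reassoc_of% hy, S.homologyι_comp_fromOpcycles, comp_zero]
  have hi : hS.exact.lift y hyq ≫ i = S.liftCycles z hzg ≫ S.homologyπ := by
    rw [← cancel_mono S.homologyι, Category.assoc, Category.assoc, S.homology_π_ι,
      S.liftCycles_i_assoc, ← hy, ← Category.assoc]
    exact congrArg (· ≫ _) (hS.exact.lift_f y hyq)
  exact ⟨R, 𝟙 R, inferInstance, pullback.lift _ _ hi, by
    rw [Category.id_comp, pullback.lift_snd_assoc, S.liftCycles_i]⟩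

end Existence

variable {t : TorsionPair A}

section

variable {U E V : A} {a : U ⟶ E} {b : E ⟶ V}

lemma nonempty (t : TorsionPair A) (h : a ≫ b = 0) : Nonempty (Cut t a b) := by
  let S := ShortComplex.mk a b h
  obtain ⟨⟨i, q, hiq⟩, hS, hX, hT, hF⟩ := t.exists_shortExact S.homology
  obtain rfl : _ = S.homology := hX
  have : Mono i := hS.mono_f
  have : Epi q := hS.epi_g
  exact ⟨⟨_, _, _, _, _, _, _, shortExact_iCycles_pOpcycles S i q hS,
    (pullback.lift_snd_assoc _ _ _ _).trans S.toCycles_i,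
    (Category.assoc _ _ _).trans ((S.pOpcycles ≫= pushout.inr_desc _ _ _).trans S.p_fromOpcycles),
    t.T_cokernel_of_exact (exact_lift_toCycles_fst S i) hT,
    t.F_kernel_of_exact (exact_inl_desc_fromOpcycles S q) hF⟩⟩

/-- A choice of cut for a pair of composable morphisms with zero composite. -/
def ofZero (t : TorsionPair A) (h : a ≫ b = 0) : Cut t a b := (nonempty t h).some

instance (D : Cut t a b) : Mono D.w := D.exact.mono_f

instance (D : Cut t a b) : Epi D.p := D.exact.epi_g

lemma w_b (D : Cut t a b) : D.w ≫ b = 0 :=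
  (D.w ≫= D.p_c).symm.trans (by rw [reassoc_of% D.w_p, zero_comp])

lemma a_p (D : Cut t a b) : a ≫ D.p = 0 :=
  (D.k_w =≫ D.p).symm.trans (by rw [Category.assoc, D.w_p, comp_zero])

lemma exists_lift (D : Cut t a b) {S : A} (x : S ⟶ E) (h : x ≫ D.p = 0) :
    ∃ y : S ⟶ D.W, y ≫ D.w = x :=
  ⟨D.exact.exact.lift x h, D.exact.exact.lift_f x h⟩

lemma exists_desc (D : Cut t a b) {S : A} (x : E ⟶ S) (h : D.w ≫ x = 0) :
    ∃ y : D.C ⟶ S, D.p ≫ y = x :=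
  ⟨D.exact.exact.desc x h, D.exact.exact.g_desc x h⟩

end

section

variable {U E V U' E' V' : A} {a : U ⟶ E} {b : E ⟶ V} {a' : U' ⟶ E'} {b' : E' ⟶ V'}
  (D : Cut t a b) (D' : Cut t a' b') {x : U ⟶ U'} {y : E ⟶ E'} {z : V ⟶ V'}

lemma w_comp_p (h₁ : a ≫ y = x ≫ a') (h₂ : y ≫ b' = b ≫ z) : D.w ≫ y ≫ D'.p = 0 := by
  refine t.eq_zero_of_comp_eq_zero D.T_mem D'.F_mem _ ?_ ?_
  · rw [reassoc_of% D.k_w, reassoc_of% h₁, D'.a_p, comp_zero]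
  · rw [Category.assoc, Category.assoc, D'.p_c, h₂, reassoc_of% D.w_b, zero_comp]

variable (h₁ : a ≫ y = x ≫ a') (h₂ : y ≫ b' = b ≫ z)

/-- The map induced on the subobjects of two cuts. -/
def mapW : D.W ⟶ D'.W :=
  D'.exact.exact.lift (D.w ≫ y) (by rw [Category.assoc, w_comp_p D D' h₁ h₂])

/-- The map induced on the quotients of two cuts. -/
def mapC : D.C ⟶ D'.C := D.exact.exact.desc (y ≫ D'.p) (w_comp_p D D' h₁ h₂)

lemma mapW_w : mapW D D' h₁ h₂ ≫ D'.w = D.w ≫ y := D'.exact.exact.lift_f _ _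

lemma p_mapC : D.p ≫ mapC D D' h₁ h₂ = y ≫ D'.p := D.exact.exact.g_desc _ _

lemma k_mapW : D.k ≫ mapW D D' h₁ h₂ = x ≫ D'.k := by
  rw [← cancel_mono D'.w, Category.assoc, mapW_w, reassoc_of% D.k_w, h₁, Category.assoc, D'.k_w]

end

end Cut

namespace Butterfly

section

variable {X Y Z W : Arrow A} {P P' : Butterfly X Y} {Q Q' : Butterfly Y Z}

lemma comp_equiv_ofHom {f : X ⟶ Z} (δ : P.E ⟶ Q.E) (hκ : P.κ ≫ δ = f.left ≫ Q.ι)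
    (hι : P.ι ≫ δ = Q.κ) (hσ : δ ≫ Q.σ = P.ρ) (hρ : δ ≫ Q.ρ = P.σ ≫ f.right) :
    comp P Q ≈ ofHom f := by
  have h0 : (pullback.snd P.ρ Q.σ - pullback.fst P.ρ Q.σ ≫ δ) ≫ Q.σ = 0 := by
    rw [Preadditive.sub_comp, Category.assoc, hσ, pullback.condition, sub_self]
  obtain ⟨s, hs⟩ : ∃ s, s ≫ Q.ι = pullback.snd P.ρ Q.σ - pullback.fst P.ρ Q.σ ≫ δ :=
    ⟨Q.exact.exact.lift _ h0, Q.exact.exact.lift_f _ h0⟩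
  have hsZ : s ≫ Z.hom = pullback.snd P.ρ Q.σ ≫ Q.ρ - pullback.fst P.ρ Q.σ ≫ P.σ ≫ f.right := by
    rw [← Q.ι_ρ, reassoc_of% hs, Preadditive.sub_comp, Category.assoc, hρ]
  refine IsComp.equiv (r := biprod.lift (pullback.fst P.ρ Q.σ ≫ P.σ) s) ⟨?_, ?_, ?_, ?_, ?_⟩
  · apply biprod.hom_ext
    · simp [reassoc_of% @compRel_fst, P.ι_σ]
    · simp [← cancel_mono Q.ι, hs, compRel_snd, reassoc_of% @compRel_fst, hι]
  · apply biprod.hom_ext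
    · simp [reassoc_of% @compκ_fst, P.κ_σ]
    · simp [← cancel_mono Q.ι, hs, compκ_snd, reassoc_of% @compκ_fst, hκ]
  · apply biprod.hom_ext
    · simp [reassoc_of% @compι_fst]
    · simp [← cancel_mono Q.ι, hs, compι_snd, reassoc_of% @compι_fst]
  · exact biprod.lift_fst _ _
  · rw [biprod.lift_desc, hsZ, Category.assoc, add_sub_cancel]

/-- The equations satisfied by the differential of the total complex between the middle objects
of two consecutive butterflies; such a `δ` witnesses that their composition is zero. -/
structure IsLink (P : Butterfly X Y) (Q : Butterfly Y Z) (δ : P.E ⟶ Q.E) : Prop where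
  κ_comp : P.κ ≫ δ = 0
  ι_comp : P.ι ≫ δ = Q.κ
  comp_σ : δ ≫ Q.σ = P.ρ
  comp_ρ : δ ≫ Q.ρ = 0

lemma exists_isLink (h : comp P Q ≈ ofHom (zeroHom X Z)) : ∃ δ, IsLink P Q δ := by
  obtain ⟨δ, hκ, hι, hσ, hρ⟩ := exists_link h
  exact ⟨δ, hκ, hι, hσ, hρ⟩

lemma IsLink.comp_equiv_zero {δ : P.E ⟶ Q.E} (h : IsLink P Q δ) :
    comp P Q ≈ ofHom (zeroHom X Z) :=
  comp_equiv_ofHom δ (h.κ_comp.trans zero_comp.symm) h.ι_comp h.comp_σ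
    (h.comp_ρ.trans comp_zero.symm)

lemma IsLink.naturality {δ : P.E ⟶ Q.E} {δ' : P'.E ⟶ Q'.E} (h : IsLink P Q δ)
    (h' : IsLink P' Q' δ') (t : TorsionPair A) (hX : t.T (cokernel X.hom))
    (hZ : t.F (kernel Z.hom)) {e : P.E ⟶ P'.E} {f : Q.E ⟶ Q'.E}
    (eκ : P.κ ≫ e = P'.κ) (eι : P.ι ≫ e = P'.ι) (eρ : e ≫ P'.ρ = P.ρ)
    (fκ : Q.κ ≫ f = Q'.κ) (fσ : f ≫ Q'.σ = Q.σ) (fρ : f ≫ Q'.ρ = Q.ρ) :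
    e ≫ δ' = δ ≫ f := by
  rw [← sub_eq_zero]
  refine eq_zero_of_torsion t hX hZ _ ?_ ?_ ?_ ?_
  · rw [Preadditive.comp_sub, reassoc_of% eκ, reassoc_of% h.κ_comp, h'.κ_comp, zero_comp, sub_self]
  · rw [Preadditive.comp_sub, reassoc_of% eι, reassoc_of% h.ι_comp, h'.ι_comp, fκ, sub_self]
  · rw [Preadditive.sub_comp, Category.assoc, Category.assoc, h'.comp_σ, fσ, h.comp_σ, eρ,
      sub_self]
  · rw [Preadditive.sub_comp, Category.assoc, Category.assoc, h'.comp_ρ, fρ, h.comp_ρ, comp_zero,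
      sub_self]

end

section

variable {t : TorsionPair A} {X Y S : Arrow A} {P : Butterfly X Y}

lemma eq_zero_of_F_kernel (hX : t.T (cokernel X.hom)) {C V : A} {c : C ⟶ V}
    (hc : t.F (kernel c)) (h : P.E ⟶ C) (hκ : P.κ ≫ h = 0) (hι : P.ι ≫ h = 0)
    (hhc : h ≫ c = 0) : h = 0 := by
  obtain ⟨y, rfl⟩ : ∃ y, P.σ ≫ y = h := ⟨P.exact.exact.desc h hι, P.exact.exact.g_desc h hι⟩
  rw [t.eq_zero_of_comp_eq_zero hX hc y, comp_zero]
  · rw [← P.κ_σ, Category.assoc, hκ]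
  · rw [← cancel_epi P.σ, ← Category.assoc, hhc, comp_zero]

lemma eq_zero_of_T_cokernel (hY : t.F (kernel Y.hom)) {U W : A} {k : U ⟶ W}
    (hk : t.T (cokernel k)) (h : W ⟶ P.E) (hσ : h ≫ P.σ = 0) (hρ : h ≫ P.ρ = 0)
    (hkh : k ≫ h = 0) : h = 0 := by
  obtain ⟨y, rfl⟩ : ∃ y, y ≫ P.ι = h := ⟨P.exact.exact.lift h hσ, P.exact.exact.lift_f h hσ⟩
  rw [t.eq_zero_of_comp_eq_zero hk hY y, zero_comp]
  · rw [← cancel_mono P.ι, Category.assoc, hkh, zero_comp]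
  · rw [← P.ι_ρ, ← Category.assoc, hρ]

/-- The inclusion of the kernel of the morphism of `B` given by `P`, as a morphism of two-term
complexes. -/
def kerι (D : Cut t P.κ P.ρ) : Arrow.mk D.k ⟶ X :=
  Arrow.homMk (𝟙 X.left) (D.w ≫ P.σ) (by simp [reassoc_of% D.k_w, P.κ_σ])

/-- The projection onto the cokernel of the morphism of `B` given by `P`, as a morphism of
two-term complexes. -/
def cokerπ (D : Cut t P.κ P.ρ) : Y ⟶ Arrow.mk D.c :=
  Arrow.homMk (P.ι ≫ D.p) (𝟙 Y.right) (by simp [D.p_c, P.ι_ρ])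

lemma isLink_kerι (D : Cut t P.κ P.ρ) : IsLink (ofHom (kerι D)) P (biprod.desc D.w P.κ) where
  κ_comp := by simp [kerι, biprod.lift_desc, D.k_w]
  ι_comp := biprod.inr_desc _ _
  comp_σ := by apply biprod.hom_ext' <;> simp [kerι, P.κ_σ]
  comp_ρ := by apply biprod.hom_ext' <;> simp [D.w_b, P.κ_ρ]

lemma isLink_cokerπ (D : Cut t P.κ P.ρ) :
    IsLink P (ofHom (cokerπ D)) (biprod.lift P.ρ (-D.p)) where
  κ_comp := by apply biprod.hom_ext <;> simp [D.a_p, P.κ_ρ]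
  ι_comp := by apply biprod.hom_ext <;> simp [cokerπ, P.ι_ρ]
  comp_σ := biprod.lift_fst _ _
  comp_ρ := by simp [cokerπ, biprod.lift_desc, D.p_c]

/-- The composite of `Q` with the inclusion of the kernel, with the middle object of `Q`. -/
abbrev postcompKer (D : Cut t P.κ P.ρ) (Q : Butterfly S (Arrow.mk D.k)) : Butterfly S X where
  E := Q.E
  κ := Q.κ
  ι := Q.ι
  σ := Q.σ
  ρ := Q.ρ ≫ D.w ≫ P.σ
  κ_σ := Q.κ_σ
  ι_ρ := by rw [reassoc_of% Q.ι_ρ]; exact ((reassoc_of% D.k_w) P.σ).trans P.κ_σ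
  κ_ρ := by rw [reassoc_of% Q.κ_ρ, zero_comp]
  ι_σ := Q.ι_σ
  exact := Q.exact

/-- The composite of the projection onto the cokernel with `Q`, with the middle object of `Q`. -/
abbrev precompCoker (D : Cut t P.κ P.ρ) (Q : Butterfly (Arrow.mk D.c) S) : Butterfly Y S where
  E := Q.E
  κ := P.ι ≫ D.p ≫ Q.κ
  ι := Q.ι
  σ := Q.σ
  ρ := Q.ρ
  κ_σ := by
    rw [Category.assoc, Category.assoc, Q.κ_σ]
    exact (P.ι ≫= D.p_c).trans P.ι_ρ
  ι_ρ := Q.ι_ρ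
  κ_ρ := by rw [Category.assoc, Category.assoc, Q.κ_ρ, comp_zero, comp_zero]
  ι_σ := Q.ι_σ
  exact := Q.exact

lemma comp_kerι_equiv (D : Cut t P.κ P.ρ) (Q : Butterfly S (Arrow.mk D.k)) :
    comp Q (ofHom (kerι D)) ≈ postcompKer D Q :=
  comp_ofHom_equiv (𝟙 _) (by simp) (by simp [kerι]) (by simp) (by simp [kerι])

lemma cokerπ_comp_equiv (D : Cut t P.κ P.ρ) (Q : Butterfly (Arrow.mk D.c) S) :
    comp (ofHom (cokerπ D)) Q ≈ precompCoker D Q :=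
  ofHom_comp_equiv (𝟙 _) (by simp [cokerπ]) (by simp) (by simp [cokerπ]) (by simp)

lemma equiv_of_comp_kerι (D : Cut t P.κ P.ρ) (hS : t.T (cokernel S.hom))
    (hY : t.F (kernel Y.hom)) {Q₁ Q₂ : Butterfly S (Arrow.mk D.k)}
    (h : comp Q₁ (ofHom (kerι D)) ≈ comp Q₂ (ofHom (kerι D))) : Q₁ ≈ Q₂ := by
  obtain ⟨e, hκ, hι, hσ, hρ⟩ : postcompKer D Q₁ ≈ postcompKer D Q₂ :=
    Setoid.trans (Setoid.symm (comp_kerι_equiv D Q₁)) (Setoid.trans h (comp_kerι_equiv D Q₂))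
  refine ⟨e, hκ, hι, hσ, ?_⟩
  dsimp only at e hκ hι hρ
  rw [← sub_eq_zero, ← cancel_mono D.w, zero_comp]
  refine eq_zero_of_torsion t (P := Q₁) (Q := P) hS hY _ ?_ ?_ ?_ ?_
  · rw [Preadditive.sub_comp, Preadditive.comp_sub]
    simp [reassoc_of% hκ, reassoc_of% Q₁.κ_ρ, reassoc_of% Q₂.κ_ρ]
  · rw [Preadditive.sub_comp, Preadditive.comp_sub]
    simp [reassoc_of% hι, reassoc_of% Q₁.ι_ρ, reassoc_of% Q₂.ι_ρ]
  · simp [hρ]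
  · rw [Category.assoc, D.w_b, comp_zero]

lemma equiv_of_cokerπ_comp (D : Cut t P.κ P.ρ) (hX : t.T (cokernel X.hom))
    (hS : t.F (kernel S.hom)) {Q₁ Q₂ : Butterfly (Arrow.mk D.c) S}
    (h : comp (ofHom (cokerπ D)) Q₁ ≈ comp (ofHom (cokerπ D)) Q₂) : Q₁ ≈ Q₂ := by
  obtain ⟨e, hκ, hι, hσ, hρ⟩ : precompCoker D Q₁ ≈ precompCoker D Q₂ :=
    Setoid.trans (Setoid.symm (cokerπ_comp_equiv D Q₁)) (Setoid.trans h (cokerπ_comp_equiv D Q₂))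
  refine ⟨e, ?_, hι, hσ, hρ⟩
  dsimp only at e hκ hσ hρ
  rw [← sub_eq_zero, ← cancel_epi D.p, comp_zero]
  refine eq_zero_of_torsion t (P := P) (Q := Q₂) hX hS _ ?_ ?_ ?_ ?_
  · rw [reassoc_of% D.a_p, zero_comp]
  · simpa [sub_eq_zero] using hκ
  · simp [hσ, Q₁.κ_σ, Q₂.κ_σ]
  · simp [hρ, Q₁.κ_ρ, Q₂.κ_ρ]

lemma IsLink.exists_lift (D : Cut t P.κ P.ρ) {Q : Butterfly S X} (hS : t.T (cokernel S.hom))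
    {δ : Q.E ⟶ P.E} (h : IsLink Q P δ) :
    ∃ d : Q.E ⟶ D.W, d ≫ D.w = δ ∧ Q.κ ≫ d = 0 ∧ Q.ι ≫ d = D.k := by
  obtain ⟨d, hd⟩ := D.exists_lift δ <| eq_zero_of_F_kernel hS D.F_mem _
    (by rw [reassoc_of% h.κ_comp, zero_comp]) (by rw [reassoc_of% h.ι_comp, D.a_p])
    (by rw [Category.assoc, D.p_c, h.comp_ρ])
  refine ⟨d, hd, ?_, ?_⟩
  · rw [← cancel_mono D.w, Category.assoc, hd, h.κ_comp, zero_comp]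
  · rw [← cancel_mono D.w, Category.assoc, hd, h.ι_comp, D.k_w]

lemma IsLink.exists_desc (D : Cut t P.κ P.ρ) {Q : Butterfly Y S} (hS : t.F (kernel S.hom))
    {δ : P.E ⟶ Q.E} (h : IsLink P Q δ) :
    ∃ d : D.C ⟶ Q.E, D.p ≫ d = δ ∧ d ≫ Q.σ = D.c ∧ d ≫ Q.ρ = 0 := by
  obtain ⟨d, hd⟩ := D.exists_desc δ <| eq_zero_of_T_cokernel hS D.T_mem _
    (by rw [Category.assoc, h.comp_σ, D.w_b]) (by rw [Category.assoc, h.comp_ρ, comp_zero])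
    (by rw [reassoc_of% D.k_w, h.κ_comp])
  refine ⟨d, hd, ?_, ?_⟩
  · rw [← cancel_epi D.p, reassoc_of% hd, h.comp_σ, D.p_c]
  · rw [← cancel_epi D.p, reassoc_of% hd, h.comp_ρ, comp_zero]

lemma exists_comp_kerι_equiv (D : Cut t P.κ P.ρ) {Q : Butterfly S X}
    (hS : t.T (cokernel S.hom)) (h : comp Q P ≈ ofHom (zeroHom S Y)) :
    ∃ R : Butterfly S (Arrow.mk D.k), comp R (ofHom (kerι D)) ≈ Q := by
  obtain ⟨δ, hδ⟩ := exists_isLink h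
  obtain ⟨d, hd, hκ, hι⟩ := hδ.exists_lift D hS
  refine ⟨{ Q with ρ := d, ι_ρ := hι, κ_ρ := hκ }, Setoid.trans (comp_kerι_equiv D _)
    (iso_of_hom (𝟙 Q.E) (by simp) (by simp) (by simp) ?_)⟩
  simp [reassoc_of% hd, hδ.comp_σ]

lemma exists_cokerπ_comp_equiv (D : Cut t P.κ P.ρ) {Q : Butterfly Y S}
    (hS : t.F (kernel S.hom)) (h : comp P Q ≈ ofHom (zeroHom X S)) :
    ∃ R : Butterfly (Arrow.mk D.c) S, comp (ofHom (cokerπ D)) R ≈ Q := by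
  obtain ⟨δ, hδ⟩ := exists_isLink h
  obtain ⟨d, hd, hσ, hρ⟩ := hδ.exists_desc D hS
  refine ⟨{ Q with κ := d, κ_σ := hσ, κ_ρ := hρ }, Setoid.trans (cokerπ_comp_equiv D _)
    (iso_of_hom (𝟙 Q.E) ?_ (by simp) (by simp) (by simp))⟩
  simp [hd, hδ.ι_comp]

end

end Butterfly

namespace Tilt

section

variable {t : TorsionPair A} {X Y : Tilt t} {P : Butterfly X.arrow Y.arrow}

/-- The kernel of the morphism of `B` given by `P`. -/
def kerObj (D : Cut t P.κ P.ρ) : Tilt t where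
  arrow := Arrow.mk D.k
  ker_mem := t.F_kernel_of_comp (g := D.w ≫ P.σ) (((reassoc_of% D.k_w) _).trans P.κ_σ) X.ker_mem
  coker_mem := D.T_mem

/-- The cokernel of the morphism of `B` given by `P`. -/
def cokerObj (D : Cut t P.κ P.ρ) : Tilt t where
  arrow := Arrow.mk D.c
  ker_mem := D.F_mem
  coker_mem := t.T_cokernel_of_comp (f := P.ι ≫ D.p)
    (by rw [Category.assoc]; exact (P.ι ≫= D.p_c).trans P.ι_ρ) Y.coker_mem

/-- The inclusion of `kerObj D`, as a morphism of `B`. -/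
def kerHom (D : Cut t P.κ P.ρ) : kerObj D ⟶ X :=
  strict (X := kerObj D) (Y := X) (Butterfly.kerι D)

/-- The projection onto `cokerObj D`, as a morphism of `B`. -/
def cokerHom (D : Cut t P.κ P.ρ) : Y ⟶ cokerObj D :=
  strict (X := Y) (Y := cokerObj D) (Butterfly.cokerπ D)

lemma kerHom_comp (D : Cut t P.κ P.ρ) : kerHom D ≫ ofB P = 0 :=
  Quotient.sound (Butterfly.isLink_kerι D).comp_equiv_zero

lemma comp_cokerHom (D : Cut t P.κ P.ρ) : ofB P ≫ cokerHom D = 0 :=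
  Quotient.sound (Butterfly.isLink_cokerπ D).comp_equiv_zero

instance (D : Cut t P.κ P.ρ) : Mono (kerHom D) where
  right_cancellation {S} f g h := by
    rw [← ofB_out f, ← ofB_out g] at h ⊢
    exact Quotient.sound (Butterfly.equiv_of_comp_kerι D S.coker_mem Y.ker_mem
      ((ofB_eq_iff (X := S) (Y := X) _ _).1 h))

instance (D : Cut t P.κ P.ρ) : Epi (cokerHom D) where
  left_cancellation {S} f g h := by
    rw [← ofB_out f, ← ofB_out g] at h ⊢
    exact Quotient.sound (Butterfly.equiv_of_cokerπ_comp D X.coker_mem S.ker_mem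
      ((ofB_eq_iff (X := Y) (Y := S) _ _).1 h))

lemma exists_comp_kerHom_eq (D : Cut t P.κ P.ρ) {S : Tilt t} (f : S ⟶ X) (h : f ≫ ofB P = 0) :
    ∃ g : S ⟶ kerObj D, g ≫ kerHom D = f := by
  rw [← ofB_out f] at h ⊢
  rw [zero_def, ofB_comp, ofB_eq_iff] at h
  obtain ⟨R, hR⟩ := Butterfly.exists_comp_kerι_equiv D S.coker_mem h
  exact ⟨ofB (Y := kerObj D) R, Quotient.sound hR⟩

lemma exists_cokerHom_comp_eq (D : Cut t P.κ P.ρ) {S : Tilt t} (f : Y ⟶ S)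
    (h : ofB P ≫ f = 0) : ∃ g : cokerObj D ⟶ S, cokerHom D ≫ g = f := by
  rw [← ofB_out f] at h ⊢
  rw [zero_def, ofB_comp, ofB_eq_iff] at h
  obtain ⟨R, hR⟩ := Butterfly.exists_cokerπ_comp_equiv D S.ker_mem h
  exact ⟨ofB (X := cokerObj D) R, Quotient.sound hR⟩

/-- The kernel fork on `kerHom D` is limiting. -/
def kerIsLimit (D : Cut t P.κ P.ρ) {f : X ⟶ Y} (hf : ofB P = f) (w : kerHom D ≫ f = 0) :
    IsLimit (KernelFork.ofι (kerHom D) w) :=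
  KernelFork.IsLimit.ofι' _ _ fun g hg =>
    have h := exists_comp_kerHom_eq D g (by rw [hf, hg])
    ⟨h.choose, h.choose_spec⟩

/-- The cokernel cofork on `cokerHom D` is colimiting. -/
def cokerIsColimit (D : Cut t P.κ P.ρ) {f : X ⟶ Y} (hf : ofB P = f) (w : f ≫ cokerHom D = 0) :
    IsColimit (CokernelCofork.ofπ (cokerHom D) w) :=
  CokernelCofork.IsColimit.ofπ' _ _ fun g hg =>
    have h := exists_cokerHom_comp_eq D g (by rw [hf, hg])
    ⟨h.choose, h.choose_spec⟩

end

end Tilt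

/-! ### Isomorphisms in the tilted category -/

variable (A) in
/-- The morphisms of two-term complexes that induce isomorphisms on kernels and cokernels. -/
def arrowQuasiIsos : MorphismProperty (Arrow A) :=
  (MorphismProperty.isomorphisms A).inverseImage (ker A) ⊓
    (MorphismProperty.isomorphisms A).inverseImage (coker A)

instance : (arrowQuasiIsos A).RespectsIso := by
  unfold arrowQuasiIsos
  infer_instance

section

variable {X₁ X₂ X₃ X₄ : A} {f : X₁ ⟶ X₂} {g : X₁ ⟶ X₃} {inl : X₂ ⟶ X₄} {inr : X₃ ⟶ X₄}
  (sq : CommSq f g inl inr)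

include sq in
lemma mono_lift_of_mono_kernel_map [Mono (kernel.map f inr g inl sq.w)] :
    Mono (biprod.lift f (-g)) := by
  rw [Preadditive.mono_iff_cancel_zero]
  intro T x hx
  have hf : x ≫ f = 0 := by simpa using hx =≫ biprod.fst
  have hg : x ≫ g = 0 := by simpa using hx =≫ biprod.snd
  have h0 : kernel.lift f x hf = 0 := by
    rw [← cancel_mono (kernel.map f inr g inl sq.w), ← cancel_mono (kernel.ι inr)]
    simp [hg]
  rw [← kernel.lift_ι f x hf, h0, zero_comp]

include sq in
lemma epi_desc_of_epi_cokernel_map [Epi (cokernel.map f inr g inl sq.w)] :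
    Epi (biprod.desc inl inr) := by
  rw [Preadditive.epi_iff_cancel_zero]
  intro T x hx
  have hl : inl ≫ x = 0 := by simpa using biprod.inl ≫= hx
  have hr : inr ≫ x = 0 := by simpa using biprod.inr ≫= hx
  have h0 : cokernel.desc inr x hr = 0 := by
    rw [← cancel_epi (cokernel.map f inr g inl sq.w), ← cancel_epi (cokernel.π f)]
    simp [hl]
  rw [← cokernel.π_desc inr x hr, h0, comp_zero]

lemma exact_of_epi_kernel_map_of_mono_cokernel_map [Epi (kernel.map f inr g inl sq.w)]
    [Mono (cokernel.map f inr g inl sq.w)] : sq.shortComplex.Exact := by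
  rw [ShortComplex.exact_iff_exact_up_to_refinements]
  intro T (z : T ⟶ X₂ ⊞ X₃) (hz : z ≫ biprod.desc inl inr = 0)
  obtain ⟨x, y, rfl⟩ : ∃ x y, z = biprod.lift x y :=
    ⟨z ≫ biprod.fst, z ≫ biprod.snd, by apply biprod.hom_ext <;> simp⟩
  rw [biprod.lift_desc] at hz
  have hx : x ≫ cokernel.π f = 0 := by
    rw [← cancel_mono (cokernel.map f inr g inl sq.w)]
    simpa using hz =≫ cokernel.π inr
  obtain ⟨T', π, _, w, hw⟩ := (ShortComplex.exact_cokernel f).exact_up_to_refinements _ hx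
  change π ≫ x = w ≫ f at hw
  have hy : (π ≫ y + w ≫ g) ≫ inr = 0 := by
    simpa [reassoc_of% hw, sq.w, add_comm] using π ≫= hz
  obtain ⟨T'', π', _, v, hv⟩ :=
    surjective_up_to_refinements_of_epi (kernel.map f inr g inl sq.w) (kernel.lift inr _ hy)
  have hv' : π' ≫ π ≫ y = v ≫ kernel.ι f ≫ g - π' ≫ w ≫ g := by
    rw [eq_sub_iff_add_eq]
    simpa using hv =≫ kernel.ι inr
  refine ⟨T'', π' ≫ π, epi_comp _ _, π' ≫ w - v ≫ kernel.ι f, ?_⟩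
  change (π' ≫ π) ≫ biprod.lift x y = (π' ≫ w - v ≫ kernel.ι f) ≫ biprod.lift f (-g)
  apply biprod.hom_ext <;> simp [hw, hv', neg_add_eq_sub]

end

lemma arrowQuasiIsos_iff_shortExact {X Y : Arrow A} (f : X ⟶ Y) :
    arrowQuasiIsos A f ↔ (ShortComplex.mk _ _ (Butterfly.ofHom f).κ_ρ).ShortExact := by
  have sq : CommSq X.hom f.left f.right Y.hom := ⟨f.w.symm⟩
  constructor
  · rintro ⟨(_ : IsIso (kernel.map X.hom Y.hom f.left f.right sq.w)),
      (_ : IsIso (cokernel.map X.hom Y.hom f.left f.right sq.w))⟩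
    exact { exact := exact_of_epi_kernel_map_of_mono_cokernel_map sq
            mono_f := mono_lift_of_mono_kernel_map sq
            epi_g := epi_desc_of_epi_cokernel_map sq }
  · intro h
    have := h.epi_g
    exact ⟨isIso_kernel_map_of_isPullback (isPullback_of_shortExact sq h),
      isIso_cokernel_map_of_isPushout
        ⟨sq, ⟨sq.isColimitEquivIsColimitCokernelCofork.symm h.exact.gIsCokernel⟩⟩⟩

namespace Butterfly

variable {X Y : Arrow A}

lemma isIso_hom_of_id_equiv_zero (h : ofHom (𝟙 X) ≈ ofHom (zeroHom X X)) : IsIso X.hom := by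
  obtain ⟨e, hκ, hι, _, hρ⟩ := h
  refine ⟨biprod.inl ≫ e.hom ≫ biprod.snd, ?_, ?_⟩
  · have hinl : X.hom ≫ biprod.inl = biprod.lift X.hom (-(𝟙 X : X ⟶ X).left) + biprod.inr := by
      apply biprod.hom_ext <;> simp
    rw [reassoc_of% hinl, Preadditive.add_comp, reassoc_of% hκ, reassoc_of% hι]
    simp [zeroHom]
  · have hdesc : biprod.desc (zeroHom X X).right X.hom = biprod.snd ≫ X.hom := by
      apply biprod.hom_ext' <;> simp [zeroHom]
    rw [Category.assoc, Category.assoc, ← hdesc]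
    exact (biprod.inl ≫= hρ).trans (by simp)

/-- The butterfly with the two diagonals exchanged, which represents the inverse morphism. -/
def flip (P : Butterfly X Y) (h : (ShortComplex.mk _ _ P.κ_ρ).ShortExact) : Butterfly Y X where
  E := P.E
  κ := P.ι
  ι := P.κ
  σ := P.ρ
  ρ := P.σ
  κ_σ := P.ι_ρ
  ι_ρ := P.κ_σ
  κ_ρ := P.ι_σ
  ι_σ := P.κ_ρ
  exact := h

lemma comp_flip (P : Butterfly X Y) (h : (ShortComplex.mk _ _ P.κ_ρ).ShortExact) :
    comp P (P.flip h) ≈ ofHom (𝟙 X) :=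
  comp_equiv_ofHom (𝟙 P.E) (by simp [flip]) (by simp [flip]) (by simp [flip]) (by simp [flip])

end Butterfly

namespace Tilt

variable {t : TorsionPair A} {X Y : Tilt t}

lemma isIso_of_id_eq_zero (h : 𝟙 X = 0) : IsIso X.arrow.hom :=
  Butterfly.isIso_hom_of_id_equiv_zero ((ofB_eq_iff _ _).1 h)

lemma shortExact_of_isIso_ofB (P : Butterfly X.arrow Y.arrow) [IsIso (ofB P)] :
    (ShortComplex.mk _ _ P.κ_ρ).ShortExact := by
  let D : Cut t P.κ P.ρ := Cut.ofZero t P.κ_ρ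
  have hker : kerHom D = 0 := by
    rw [← cancel_mono (ofB P), kerHom_comp, zero_comp]
  have : IsIso D.k := isIso_of_id_eq_zero (X := kerObj D) (by
    rw [← cancel_mono (kerHom D), hker, comp_zero, comp_zero])
  have hcoker : cokerHom D = 0 := by
    rw [← cancel_epi (ofB P), comp_cokerHom, comp_zero]
  have : IsIso D.c := isIso_of_id_eq_zero (X := cokerObj D) (by
    rw [← cancel_epi (cokerHom D), hcoker, zero_comp, zero_comp])
  exact ShortComplex.shortExact_of_iso
    (ShortComplex.isoMk (asIso D.k).symm (Iso.refl P.E) (asIso D.c)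
      (by simp [← cancel_epi D.k, D.k_w]) (by simp [D.p_c])) D.exact

lemma isIso_ofB_iff (P : Butterfly X.arrow Y.arrow) :
    IsIso (ofB P) ↔ (ShortComplex.mk _ _ P.κ_ρ).ShortExact :=
  ⟨fun _ => shortExact_of_isIso_ofB P, fun h =>
    ⟨ofB (P.flip h), Quotient.sound (P.comp_flip h),
      Quotient.sound ((P.flip h).comp_flip P.exact)⟩⟩

lemma isIso_strict_iff (f : X.arrow ⟶ Y.arrow) :
    IsIso (strict f : X ⟶ Y) ↔ arrowQuasiIsos A f := by
  rw [strict, isIso_ofB_iff, arrowQuasiIsos_iff_shortExact]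

end Tilt

/-! ### Homology in the tilted category -/

lemma f'_comp_eq_of_comp_i_eq {C : Type*} [Category* C] [HasZeroMorphisms C] {S S' : ShortComplex C}
    {φ : S ⟶ S'} {h : S.LeftHomologyData} {h' : S'.LeftHomologyData} {φK : h.K ⟶ h'.K}
    (comm : φK ≫ h'.i = h.i ≫ φ.τ₂) : h.f' ≫ φK = φ.τ₁ ≫ h'.f' := by
  rw [← cancel_mono h'.i, Category.assoc, comm, h.f'_i_assoc, Category.assoc, h'.f'_i, φ.comm₁₂]

namespace Butterfly.IsLink

variable {t : TorsionPair A} {X Y Z : Arrow A} {P : Butterfly X Y} {Q : Butterfly Y Z}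
  {δ : P.E ⟶ Q.E} (D₁ : Cut t P.κ P.ρ) (D₂ : Cut t Q.κ Q.ρ) (hX : t.T (cokernel X.hom))
  (hZ : t.F (kernel Z.hom)) (h : IsLink P Q δ)

include hX hZ h in
lemma exists_mid : ∃ m : D₁.C ⟶ D₂.W, D₁.p ≫ m ≫ D₂.w = δ := by
  obtain ⟨d, hd, -⟩ := h.exists_lift D₂ hX
  obtain ⟨d', hd', -⟩ := h.exists_desc D₁ hZ
  obtain ⟨m, hm⟩ := D₁.exists_desc d (by
    rw [← cancel_mono D₂.w, Category.assoc, hd, ← hd', reassoc_of% D₁.w_p, zero_comp, zero_comp])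
  exact ⟨m, by rw [reassoc_of% hm, hd]⟩

/-- The two-term complex induced by a link between cuts of the two butterflies. It represents the
homology of the corresponding short complex in `B`. -/
def mid : D₁.C ⟶ D₂.W := (h.exists_mid D₁ D₂ hX hZ).choose

lemma p_mid_w : D₁.p ≫ h.mid D₁ D₂ hX hZ ≫ D₂.w = δ := (h.exists_mid D₁ D₂ hX hZ).choose_spec

lemma ι_p_mid : P.ι ≫ D₁.p ≫ h.mid D₁ D₂ hX hZ = D₂.k := by
  rw [← cancel_mono D₂.w, Category.assoc, Category.assoc, p_mid_w, D₂.k_w, h.ι_comp]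

lemma mid_w_σ : h.mid D₁ D₂ hX hZ ≫ D₂.w ≫ Q.σ = D₁.c := by
  rw [← cancel_epi D₁.p, D₁.p_c, reassoc_of% h.p_mid_w, h.comp_σ]

end Butterfly.IsLink

namespace Tilt

variable {t : TorsionPair A}

section

variable {X Y X' Y' : Tilt t} {P : Butterfly X.arrow Y.arrow} {P' : Butterfly X'.arrow Y'.arrow}
  (D : Cut t P.κ P.ρ) (D' : Cut t P'.κ P'.ρ)

lemma strict_comp_kerHom {f : X.arrow ⟶ X'.arrow} {g : D.W ⟶ D'.W}
    (hk : f.left ≫ D'.k = D.k ≫ g) (hσ : g ≫ D'.w ≫ P'.σ = (D.w ≫ P.σ) ≫ f.right) :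
    strict (X := kerObj D) (Y := kerObj D')
        (Arrow.homMk f.left g hk : Arrow.mk D.k ⟶ Arrow.mk D'.k) ≫ kerHom D' =
      kerHom D ≫ strict f := by
  have h : (Arrow.homMk f.left g hk : Arrow.mk D.k ⟶ Arrow.mk D'.k) ≫ Butterfly.kerι D' =
      Butterfly.kerι D ≫ f := by
    ext
    · exact (Category.comp_id _).trans (Category.id_comp _).symm
    · exact hσ
  exact (strict_comp (X := kerObj D) (Y := kerObj D') (Z := X') _ _).symm.trans
    ((congrArg strict h).trans (strict_comp (X := kerObj D) (Y := X) (Z := X') _ _))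

lemma cokerHom_comp_strict {f : Y.arrow ⟶ Y'.arrow} {g : D.C ⟶ D'.C}
    (hc : g ≫ D'.c = D.c ≫ f.right) (hι : (P.ι ≫ D.p) ≫ g = f.left ≫ P'.ι ≫ D'.p) :
    cokerHom D ≫ strict (X := cokerObj D) (Y := cokerObj D')
        (Arrow.homMk g f.right hc : Arrow.mk D.c ⟶ Arrow.mk D'.c) =
      strict f ≫ cokerHom D' := by
  have h : Butterfly.cokerπ D ≫ (Arrow.homMk g f.right hc : Arrow.mk D.c ⟶ Arrow.mk D'.c) =
      f ≫ Butterfly.cokerπ D' := by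
    ext
    · exact hι
    · exact (Category.id_comp _).trans (Category.comp_id _).symm
  exact (strict_comp (X := Y) (Y := cokerObj D) (Z := cokerObj D') _ _).symm.trans
    ((congrArg strict h).trans (strict_comp (X := Y) (Y := Y') (Z := cokerObj D') _ _))

end

/-- The choices from which the homology of a short complex in `B` is computed: representatives of
the two morphisms, the link between them, and a cut of each. -/
structure HomologyPresentation (S : ShortComplex (Tilt t)) where
  P : Butterfly S.X₁.arrow S.X₂.arrow
  Q : Butterfly S.X₂.arrow S.X₃.arrow
  P_eq : ofB P = S.f
  Q_eq : ofB Q = S.g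
  δ : P.E ⟶ Q.E
  isLink : Butterfly.IsLink P Q δ
  D₁ : Cut t P.κ P.ρ
  D₂ : Cut t Q.κ Q.ρ

namespace HomologyPresentation

variable {S : ShortComplex (Tilt t)} (R : HomologyPresentation S)

/-- The two-term complex that represents the homology. -/
def m : R.D₁.C ⟶ R.D₂.W := R.isLink.mid R.D₁ R.D₂ S.X₁.coker_mem S.X₃.ker_mem

lemma p_m_w : R.D₁.p ≫ R.m ≫ R.D₂.w = R.δ := R.isLink.p_mid_w _ _ _ _

lemma ι_p_m : R.P.ι ≫ R.D₁.p ≫ R.m = R.D₂.k := R.isLink.ι_p_mid _ _ _ _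

lemma m_w_σ : R.m ≫ R.D₂.w ≫ R.Q.σ = R.D₁.c := R.isLink.mid_w_σ _ _ _ _

lemma p_m_w_σ : (R.D₁.p ≫ R.m) ≫ R.D₂.w ≫ R.Q.σ = R.P.ρ := by
  rw [Category.assoc, R.m_w_σ, R.D₁.p_c]

lemma ι_p_m_w : R.P.ι ≫ R.D₁.p ≫ R.m ≫ R.D₂.w = R.Q.κ := by
  rw [reassoc_of% R.ι_p_m, R.D₂.k_w]

/-- The morphism to the kernel of `S.g` induced by `S.f`. -/
def toKer : Butterfly S.X₁.arrow (kerObj R.D₂).arrow where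
  E := R.P.E
  κ := R.P.κ
  ι := R.P.ι
  σ := R.P.σ
  ρ := R.D₁.p ≫ R.m
  κ_σ := R.P.κ_σ
  ι_ρ := R.ι_p_m
  κ_ρ := ((reassoc_of% R.D₁.a_p) R.m).trans zero_comp
  ι_σ := R.P.ι_σ
  exact := R.P.exact

/-- The morphism from the cokernel of `S.f` induced by `S.g`. -/
def fromCoker : Butterfly (cokerObj R.D₁).arrow S.X₃.arrow where
  E := R.Q.E
  κ := R.m ≫ R.D₂.w
  ι := R.Q.ι
  σ := R.Q.σ
  ρ := R.Q.ρ
  κ_σ := (Category.assoc _ _ _).trans R.m_w_σ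
  ι_ρ := R.Q.ι_ρ
  κ_ρ := (Category.assoc _ _ _).trans ((R.m ≫= R.D₂.w_b).trans comp_zero)
  ι_σ := R.Q.ι_σ
  exact := R.Q.exact

lemma toKer_comp : ofB R.toKer ≫ kerHom R.D₂ = S.f :=
  (Quotient.sound (Setoid.trans (Butterfly.comp_kerι_equiv R.D₂ R.toKer)
    (Butterfly.iso_of_hom (𝟙 R.P.E) (Category.comp_id _) (Category.comp_id _) (Category.id_comp _)
      ((Category.id_comp _).trans R.p_m_w_σ.symm)))).trans R.P_eq

lemma comp_fromCoker : cokerHom R.D₁ ≫ ofB R.fromCoker = S.g :=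
  (Quotient.sound (Setoid.trans (Butterfly.cokerπ_comp_equiv R.D₁ R.fromCoker)
    (Butterfly.iso_of_hom (𝟙 R.Q.E) ((Category.comp_id _).trans R.ι_p_m_w)
      (Category.comp_id _) (Category.id_comp _) (Category.id_comp _)))).trans R.Q_eq

/-- The cut of `R.toKer` induced by `R.D₁`. -/
def cutToKer : Cut t R.toKer.κ R.toKer.ρ where
  W := R.D₁.W
  C := R.D₁.C
  k := R.D₁.k
  w := R.D₁.w
  p := R.D₁.p
  c := R.m
  w_p := R.D₁.w_p
  exact := R.D₁.exact
  k_w := R.D₁.k_w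
  p_c := rfl
  T_mem := R.D₁.T_mem
  F_mem := t.F_kernel_of_comp R.m_w_σ R.D₁.F_mem

/-- The cut of `R.fromCoker` induced by `R.D₂`. -/
def cutFromCoker : Cut t R.fromCoker.κ R.fromCoker.ρ where
  W := R.D₂.W
  C := R.D₂.C
  k := R.m
  w := R.D₂.w
  p := R.D₂.p
  c := R.D₂.c
  w_p := R.D₂.w_p
  exact := R.D₂.exact
  k_w := rfl
  p_c := R.D₂.p_c
  T_mem := t.T_cokernel_of_comp (f := R.P.ι ≫ R.D₁.p) (by rw [Category.assoc, R.ι_p_m]) R.D₂.T_mem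
  F_mem := R.D₂.F_mem

lemma kerHom_comp : kerHom R.D₂ ≫ S.g = 0 := by rw [← R.Q_eq, Tilt.kerHom_comp]

lemma comp_cokerHom : S.f ≫ cokerHom R.D₁ = 0 := by rw [← R.P_eq, Tilt.comp_cokerHom]

lemma lift_eq : ofB R.toKer =
    (kerIsLimit R.D₂ R.Q_eq R.kerHom_comp).lift (KernelFork.ofι S.f S.zero) := by
  rw [← cancel_mono (kerHom R.D₂), toKer_comp]
  exact ((kerIsLimit R.D₂ R.Q_eq R.kerHom_comp).fac (KernelFork.ofι S.f S.zero)
    WalkingParallelPair.zero).symm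

lemma desc_eq : ofB R.fromCoker =
    (cokerIsColimit R.D₁ R.P_eq R.comp_cokerHom).desc (CokernelCofork.ofπ S.g S.zero) := by
  rw [← cancel_epi (cokerHom R.D₁), comp_fromCoker]
  exact ((cokerIsColimit R.D₁ R.P_eq R.comp_cokerHom).fac (CokernelCofork.ofπ S.g S.zero)
    WalkingParallelPair.one).symm

/-- The left homology data given by the kernel of `S.g` and the cokernel of the induced map. -/
def leftHomologyData : S.LeftHomologyData where
  K := kerObj R.D₂
  H := cokerObj R.cutToKer
  i := kerHom R.D₂
  π := cokerHom R.cutToKer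
  wi := R.kerHom_comp
  hi := kerIsLimit R.D₂ R.Q_eq R.kerHom_comp
  wπ := by rw [← lift_eq, Tilt.comp_cokerHom]
  hπ := cokerIsColimit R.cutToKer R.lift_eq _

/-- The right homology data given by the cokernel of `S.f` and the kernel of the induced map. -/
def rightHomologyData : S.RightHomologyData where
  Q := cokerObj R.D₁
  H := kerObj R.cutFromCoker
  p := cokerHom R.D₁
  ι := kerHom R.cutFromCoker
  wp := R.comp_cokerHom
  hp := cokerIsColimit R.D₁ R.P_eq R.comp_cokerHom
  wι := by rw [← desc_eq, Tilt.kerHom_comp]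
  hι := kerIsLimit R.cutFromCoker R.desc_eq _

lemma cokerHom_comp_kerHom :
    (cokerHom R.cutToKer : kerObj R.D₂ ⟶ cokerObj R.cutToKer) ≫
      (kerHom R.cutFromCoker : cokerObj R.cutToKer ⟶ cokerObj R.D₁) =
      kerHom R.D₂ ≫ cokerHom R.D₁ := by
  have h : Butterfly.cokerπ R.cutToKer ≫ Butterfly.kerι R.cutFromCoker =
      Butterfly.kerι R.D₂ ≫ Butterfly.cokerπ R.D₁ := by
    ext
    · exact (Category.comp_id _).trans (Category.id_comp _).symm
    · exact (Category.id_comp _).trans (Category.comp_id _).symm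
  exact (strict_comp (X := kerObj R.D₂) (Y := cokerObj R.cutToKer) (Z := cokerObj R.D₁)
    _ _).symm.trans ((congrArg strict h).trans
    (strict_comp (X := kerObj R.D₂) (Y := S.X₂) (Z := cokerObj R.D₁) _ _))

/-- The left and right homology objects of a presentation coincide. -/
def homologyData : S.HomologyData where
  left := R.leftHomologyData
  right := R.rightHomologyData
  iso := Iso.refl _
  comm := (congrArg (cokerHom R.cutToKer ≫ ·)
    (Category.id_comp (X := cokerObj R.cutToKer) (kerHom R.cutFromCoker))).trans
    R.cokerHom_comp_kerHom

lemma hasHomology (R : HomologyPresentation S) : S.HasHomology := ⟨⟨R.homologyData⟩⟩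

section

variable {R} {S' : ShortComplex (Tilt t)} {R' : HomologyPresentation S'} {φ : S ⟶ S'}
  {f : S.X₂.arrow ⟶ S'.X₂.arrow} (hf : φ.τ₂ = strict f) {g₁ : R.D₁.C ⟶ R'.D₁.C}
  {g₂ : R.D₂.W ⟶ R'.D₂.W} (comm : g₁ ≫ R'.m = R.m ≫ g₂)
  (hι : (R.P.ι ≫ R.D₁.p) ≫ g₁ = f.left ≫ R'.P.ι ≫ R'.D₁.p) (hk : f.left ≫ R'.D₂.k = R.D₂.k ≫ g₂)
  (hσ : g₂ ≫ R'.D₂.w ≫ R'.Q.σ = (R.D₂.w ≫ R.Q.σ) ≫ f.right)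

/-- The map of homology data induced by compatible morphisms between the cuts. -/
def leftHomologyMapData :
    ShortComplex.LeftHomologyMapData φ R.leftHomologyData R'.leftHomologyData :=
  let fK : (kerObj R.D₂).arrow ⟶ (kerObj R'.D₂).arrow :=
    (Arrow.homMk f.left g₂ hk : Arrow.mk R.D₂.k ⟶ Arrow.mk R'.D₂.k)
  let fH : (cokerObj R.cutToKer).arrow ⟶ (cokerObj R'.cutToKer).arrow :=
    (Arrow.homMk g₁ g₂ comm : Arrow.mk R.m ⟶ Arrow.mk R'.m)
  have commi : strict fK ≫ kerHom R'.D₂ = kerHom R.D₂ ≫ φ.τ₂ :=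
    (strict_comp_kerHom R.D₂ R'.D₂ hk hσ).trans (congrArg (kerHom R.D₂ ≫ ·) hf.symm)
  { φK := strict fK
    φH := strict fH
    commi := commi
    commf' := f'_comp_eq_of_comp_i_eq commi
    commπ := cokerHom_comp_strict (f := fK) (g := g₁) R.cutToKer R'.cutToKer comm hι }

include hf hι hk hσ in
lemma quasiIso_iff [S.HasHomology] [S'.HasHomology] :
    ShortComplex.QuasiIso φ ↔
      arrowQuasiIsos A (Arrow.homMk g₁ g₂ comm : Arrow.mk R.m ⟶ Arrow.mk R'.m) := by
  rw [(leftHomologyMapData (R := R) (R' := R') hf comm hι hk hσ).quasiIso_iff]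
  exact isIso_strict_iff (X := cokerObj R.cutToKer) (Y := cokerObj R'.cutToKer)
    (Arrow.homMk g₁ g₂ comm : Arrow.mk R.m ⟶ Arrow.mk R'.m)

end

end HomologyPresentation

end Tilt

/-! ### The torsion filtration of homology -/

section

variable {S S' : ShortComplex A} (φ : S ⟶ S') [IsIso φ.τ₂] (w : S'.f ≫ inv φ.τ₂ ≫ S.g = 0)

include w

lemma isIso_τ₁_of_isIso_τ₂ (hS : S.ShortExact) [Mono S'.f] : IsIso φ.τ₁ := by
  have := hS.mono_f
  obtain ⟨s, hs⟩ := hS.exact.lift' (S'.f ≫ inv φ.τ₂) (by rw [Category.assoc, w])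
  refine ⟨s, ?_, ?_⟩
  · rw [← cancel_mono S.f, Category.assoc, hs, φ.comm₁₂_assoc, IsIso.hom_inv_id, Category.comp_id,
      Category.id_comp]
  · rw [← cancel_mono S'.f, Category.assoc, φ.comm₁₂, reassoc_of% hs, IsIso.inv_hom_id,
      Category.comp_id, Category.id_comp]

lemma isIso_τ₃_of_isIso_τ₂ (hS' : S'.ShortExact) [Epi S.g] : IsIso φ.τ₃ := by
  have := hS'.epi_g
  obtain ⟨s, hs⟩ := hS'.exact.desc' (inv φ.τ₂ ≫ S.g) w
  refine ⟨s, ?_, ?_⟩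
  · rw [← cancel_epi S.g, ← φ.comm₂₃_assoc, hs, IsIso.hom_inv_id_assoc, Category.comp_id]
  · rw [← cancel_epi S'.g, reassoc_of% hs, ← φ.comm₂₃, IsIso.inv_hom_id_assoc, Category.comp_id]

end

lemma isIso_τ₂_iff {S S' : ShortComplex A} (φ : S ⟶ S') (hS : S.ShortExact)
    (hS' : S'.ShortExact) (h₀ : ∀ f : S'.X₁ ⟶ S.X₃, f = 0) :
    IsIso φ.τ₂ ↔ IsIso φ.τ₁ ∧ IsIso φ.τ₃ := by
  have := hS'.mono_f
  have := hS.epi_g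
  exact ⟨fun _ => ⟨isIso_τ₁_of_isIso_τ₂ φ (h₀ _) hS, isIso_τ₃_of_isIso_τ₂ φ (h₀ _) hS'⟩,
    fun ⟨_, _⟩ => ShortComplex.isIso₂_of_shortExact_of_isIso₁₃ φ hS hS'⟩

/-- A factorization of a short complex through a short exact sequence `W ⟶ S.X₂ ⟶ C`, which
filters the homology of `S` by the cokernel of `l` and the kernel of `r`. -/
structure HomologyCut (S : ShortComplex A) where
  {U W C V : A}
  e : S.X₁ ⟶ U
  l : U ⟶ W
  w : W ⟶ S.X₂
  p : S.X₂ ⟶ C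
  r : C ⟶ V
  m : V ⟶ S.X₃
  epi_e : Epi e
  mono_m : Mono m
  w_p : w ≫ p = 0
  exact : (ShortComplex.mk w p w_p).ShortExact
  e_l_w : e ≫ l ≫ w = S.f
  p_r_m : p ≫ r ≫ m = S.g

namespace HomologyCut

attribute [instance] epi_e mono_m

section

variable {S : ShortComplex A} (D : HomologyCut S)

instance : Mono D.w := D.exact.mono_f

instance : Epi D.p := D.exact.epi_g

lemma w_g : D.w ≫ S.g = 0 := by rw [← D.p_r_m, reassoc_of% D.w_p, zero_comp]

lemma f_p : S.f ≫ D.p = 0 := by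
  rw [← D.e_l_w, Category.assoc, Category.assoc, D.w_p, comp_zero, comp_zero]

lemma e_l_liftCycles : D.e ≫ D.l ≫ S.liftCycles D.w D.w_g = S.toCycles := by
  rw [← cancel_mono S.iCycles, Category.assoc, Category.assoc, S.liftCycles_i, D.e_l_w,
    S.toCycles_i]

lemma descOpcycles_r_m : S.descOpcycles D.p D.f_p ≫ D.r ≫ D.m = S.fromOpcycles := by
  rw [← cancel_epi S.pOpcycles, S.p_descOpcycles_assoc, D.p_r_m, S.p_fromOpcycles]

/-- The map from the cokernel of `l` to the homology. -/
def incl : cokernel D.l ⟶ S.homology :=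
  cokernel.desc D.l (S.liftCycles D.w D.w_g ≫ S.homologyπ) (by
    rw [← cancel_epi D.e, reassoc_of% D.e_l_liftCycles, S.toCycles_comp_homologyπ, comp_zero])

/-- The map from the homology to the kernel of `r`. -/
def proj : S.homology ⟶ kernel D.r :=
  kernel.lift D.r (S.homologyι ≫ S.descOpcycles D.p D.f_p) (by
    rw [← cancel_mono D.m, Category.assoc, Category.assoc, D.descOpcycles_r_m,
      S.homologyι_comp_fromOpcycles, zero_comp])

lemma π_incl : cokernel.π D.l ≫ D.incl = S.liftCycles D.w D.w_g ≫ S.homologyπ :=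
  cokernel.π_desc _ _ _

lemma proj_ι : D.proj ≫ kernel.ι D.r = S.homologyι ≫ S.descOpcycles D.p D.f_p :=
  kernel.lift_ι _ _ _

lemma homologyπ_proj_ι : S.homologyπ ≫ D.proj ≫ kernel.ι D.r = S.iCycles ≫ D.p := by
  rw [proj_ι, S.homology_π_ι_assoc, S.p_descOpcycles]

lemma incl_proj : D.incl ≫ D.proj = 0 := by
  rw [← cancel_epi (cokernel.π D.l), ← cancel_mono (kernel.ι D.r), Category.assoc,
    Category.assoc, reassoc_of% D.π_incl, homologyπ_proj_ι, S.liftCycles_i_assoc, D.w_p,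
    comp_zero, zero_comp]

instance mono_incl : Mono D.incl := by
  rw [Preadditive.mono_iff_cancel_zero]
  intro T x hx
  obtain ⟨T', π, _, y, hy⟩ := surjective_up_to_refinements_of_epi (cokernel.π D.l) x
  have hy₀ : (y ≫ S.liftCycles D.w D.w_g) ≫ S.homologyπ = 0 := by
    rw [Category.assoc, ← π_incl, ← reassoc_of% hy, hx, comp_zero]
  rw [S.comp_homologyπ_eq_zero_iff_up_to_refinements] at hy₀
  obtain ⟨T'', π', _, z, hz⟩ := hy₀
  have hyz : π' ≫ y = (z ≫ D.e) ≫ D.l := by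
    rw [← cancel_mono D.w, ← S.liftCycles_i D.w D.w_g]
    simpa [← D.e_l_w] using hz =≫ S.iCycles
  rw [← cancel_epi π, ← cancel_epi π', hy, reassoc_of% hyz, cokernel.condition, comp_zero,
    comp_zero, comp_zero, comp_zero]

instance epi_proj : Epi D.proj := by
  rw [epi_iff_surjective_up_to_refinements]
  intro T x
  obtain ⟨T', π, hπ, y, hy⟩ := surjective_up_to_refinements_of_epi D.p (x ≫ kernel.ι D.r)
  have hyg : y ≫ S.g = 0 := by
    rw [← D.p_r_m, ← reassoc_of% hy, kernel.condition_assoc, zero_comp, comp_zero, comp_zero]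
  refine ⟨T', π, hπ, S.liftCycles y hyg ≫ S.homologyπ, ?_⟩
  rw [← cancel_mono (kernel.ι D.r), Category.assoc, hy, Category.assoc, Category.assoc,
    homologyπ_proj_ι, S.liftCycles_i_assoc]

lemma exact_incl_proj : (ShortComplex.mk D.incl D.proj D.incl_proj).Exact := by
  rw [ShortComplex.exact_iff_exact_up_to_refinements]
  intro T γ (hγ : γ ≫ D.proj = 0)
  obtain ⟨T', π, hπ, z, hz, hγz⟩ := S.eq_liftCycles_homologyπ_up_to_refinements γ
  have hzp : z ≫ D.p = 0 := by
    rw [← S.liftCycles_i z hz, Category.assoc, ← homologyπ_proj_ι, ← reassoc_of% hγz,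
      reassoc_of% hγ, zero_comp, comp_zero]
  let y : T' ⟶ D.W := D.exact.exact.lift z hzp
  have hy : y ≫ D.w = z := D.exact.exact.lift_f z hzp
  have hyz : S.liftCycles z hz = y ≫ S.liftCycles D.w D.w_g := by
    rw [← cancel_mono S.iCycles, Category.assoc, S.liftCycles_i, S.liftCycles_i, hy]
  exact ⟨T', π, hπ, y ≫ cokernel.π D.l, by
    rw [Category.assoc, hγz, hyz, Category.assoc, ← π_incl]⟩

lemma shortExact : (ShortComplex.mk D.incl D.proj D.incl_proj).ShortExact where
  mono_f := D.mono_incl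
  epi_g := D.epi_proj
  exact := D.exact_incl_proj

end

variable {S S' : ShortComplex A} {φ : S ⟶ S'} {D : HomologyCut S} {D' : HomologyCut S'}
  {gU : D.U ⟶ D'.U} {gW : D.W ⟶ D'.W} {gC : D.C ⟶ D'.C} {gV : D.V ⟶ D'.V}

lemma incl_naturality (hw : gW ≫ D'.w = D.w ≫ φ.τ₂) (hl : D.l ≫ gW = gU ≫ D'.l) :
    cokernel.map D.l D'.l gU gW hl ≫ D'.incl = D.incl ≫ ShortComplex.homologyMap φ := by
  have hcyc : gW ≫ S'.liftCycles D'.w D'.w_g =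
      S.liftCycles D.w D.w_g ≫ ShortComplex.cyclesMap φ := by
    rw [← cancel_mono S'.iCycles, Category.assoc, S'.liftCycles_i, hw, Category.assoc,
      ShortComplex.cyclesMap_i, S.liftCycles_i_assoc]
  rw [← cancel_epi (cokernel.π D.l), cokernel.π_desc_assoc, Category.assoc, π_incl,
    reassoc_of% hcyc, reassoc_of% D.π_incl, ShortComplex.homologyπ_naturality]

lemma proj_naturality (hp : D.p ≫ gC = φ.τ₂ ≫ D'.p) (hr : D.r ≫ gV = gC ≫ D'.r) :
    ShortComplex.homologyMap φ ≫ D'.proj = D.proj ≫ kernel.map D.r D'.r gC gV hr := by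
  have hop : S.descOpcycles D.p D.f_p ≫ gC =
      ShortComplex.opcyclesMap φ ≫ S'.descOpcycles D'.p D'.f_p := by
    rw [← cancel_epi S.pOpcycles, S.p_descOpcycles_assoc, hp, ShortComplex.p_opcyclesMap_assoc,
      S'.p_descOpcycles]
  rw [← cancel_mono (kernel.ι D'.r), Category.assoc, Category.assoc, kernel.lift_ι, proj_ι,
    reassoc_of% D.proj_ι, hop, ShortComplex.homologyι_naturality_assoc]

lemma quasiIso_iff (h₀ : ∀ f : cokernel D'.l ⟶ kernel D.r, f = 0)
    (hw : gW ≫ D'.w = D.w ≫ φ.τ₂) (hp : D.p ≫ gC = φ.τ₂ ≫ D'.p)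
    (hl : D.l ≫ gW = gU ≫ D'.l) (hr : D.r ≫ gV = gC ≫ D'.r) :
    ShortComplex.QuasiIso φ ↔
      IsIso (cokernel.map D.l D'.l gU gW hl) ∧ IsIso (kernel.map D.r D'.r gC gV hr) := by
  rw [ShortComplex.quasiIso_iff]
  exact isIso_τ₂_iff (S := .mk D.incl D.proj D.incl_proj) (S' := .mk D'.incl D'.proj D'.incl_proj)
    { τ₁ := cokernel.map D.l D'.l gU gW hl
      τ₂ := ShortComplex.homologyMap φ
      τ₃ := kernel.map D.r D'.r gC gV hr
      comm₁₂ := incl_naturality hw hl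
      comm₂₃ := proj_naturality hp hr } D.shortExact D'.shortExact h₀

end HomologyCut

/-! ### Quasi-isomorphisms -/

lemma forall_int_add_one_iff {p : ℤ → Prop} : (∀ n, p (n + 1)) ↔ ∀ n, p n :=
  (Equiv.addRight (1 : ℤ)).forall_congr_right

namespace Tot

variable {t : TorsionPair A}

/-- A cut of the middle object `E n`. -/
def cut (X : ChSt t) (n : ℤ) : Cut t (rep X n).κ (rep X n).ρ := Cut.ofZero t (rep X n).κ_ρ

lemma isLink_δ (X : ChSt t) (n : ℤ) : (rep X n).IsLink (rep X (n + 1)) (δ X n) :=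
  ⟨κ_δ X n, ι_δ X n, δ_σ X n, δ_ρ X n⟩

/-- The presentation of the cohomology in degree `n + 1` of a complex in `B`. -/
def presentation (X : ChSt t) (n : ℤ) :
    Tilt.HomologyPresentation (X.cx.sc' n (n + 1) (n + 1 + 1)) where
  P := rep X n
  Q := rep X (n + 1)
  P_eq := Tilt.ofB_out _
  Q_eq := Tilt.ofB_out _
  δ := δ X n
  isLink := isLink_δ X n
  D₁ := cut X n
  D₂ := cut X (n + 1)

/-- The two-term complex representing the cohomology in degree `n + 1` of a complex in `B`. -/
def mid (X : ChSt t) (n : ℤ) : (cut X n).C ⟶ (cut X (n + 1)).W := (presentation X n).m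

lemma p_mid_w (X : ChSt t) (n : ℤ) : (cut X n).p ≫ mid X n ≫ (cut X (n + 1)).w = δ X n :=
  (presentation X n).p_m_w

/-- The cuts of the middle objects filter the cohomology of the complex underlying `Tot X`. -/
def homologyCut (X : ChSt t) (n : ℤ) :
    HomologyCut ((auxObj X).cx.sc' n (n + 1) (n + 1 + 1)) where
  U := (cut X n).C
  W := (cut X (n + 1)).W
  C := (cut X (n + 1)).C
  V := (cut X (n + 1 + 1)).W
  e := (cut X n).p
  l := mid X n
  w := (cut X (n + 1)).w
  p := (cut X (n + 1)).p
  r := mid X (n + 1)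
  m := (cut X (n + 1 + 1)).w
  epi_e := inferInstanceAs (Epi (cut X n).p)
  mono_m := inferInstanceAs (Mono (cut X (n + 1 + 1)).w)
  w_p := (cut X (n + 1)).w_p
  exact := (cut X (n + 1)).exact
  e_l_w := (p_mid_w X n).trans (auxObj_d X n).symm
  p_r_m := (p_mid_w X (n + 1)).trans (auxObj_d X (n + 1)).symm

section

variable {X Y : ChSt t} (φ : X ⟶ Y) (n : ℤ)

/-- The map induced on the subobjects of the cuts. -/
def mapW : (cut X n).W ⟶ (cut Y n).W := (cut X n).mapW (cut Y n) (κ_map φ n) (map_ρ φ n)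

/-- The map induced on the quotients of the cuts. -/
def mapC : (cut X n).C ⟶ (cut Y n).C := (cut X n).mapC (cut Y n) (κ_map φ n) (map_ρ φ n)

lemma mapW_w : mapW φ n ≫ (cut Y n).w = (cut X n).w ≫ map φ n := Cut.mapW_w _ _ _ _

lemma p_mapC : (cut X n).p ≫ mapC φ n = map φ n ≫ (cut Y n).p := Cut.p_mapC _ _ _ _

lemma k_mapW : (cut X n).k ≫ mapW φ n = (ChSt.Hom.f φ n).left ≫ (cut Y n).k :=
  Cut.k_mapW _ _ _ _

lemma mapC_mid : mapC φ n ≫ mid Y n = mid X n ≫ mapW φ (n + 1) := by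
  rw [← cancel_epi (cut X n).p, ← cancel_mono (cut Y (n + 1)).w]
  simp only [Category.assoc]
  rw [reassoc_of% p_mapC, p_mid_w, mapW_w, reassoc_of% p_mid_w, map_δ]

/-- The map induced on the cohomology in degree `n + 1`. -/
def midMap : Arrow.mk (mid X n) ⟶ Arrow.mk (mid Y n) :=
  Arrow.homMk (mapC φ n) (mapW φ (n + 1)) (mapC_mid φ n)

lemma quasiIso_sc'_iff [(((ChSt.toCh t).obj X).sc' n (n + 1) (n + 1 + 1)).HasHomology]
    [(((ChSt.toCh t).obj Y).sc' n (n + 1) (n + 1 + 1)).HasHomology] :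
    ShortComplex.QuasiIso (S₁ := ((ChSt.toCh t).obj X).sc' n (n + 1) (n + 1 + 1))
      (S₂ := ((ChSt.toCh t).obj Y).sc' n (n + 1) (n + 1 + 1))
      ((HomologicalComplex.shortComplexFunctor' (Tilt t) _ n (n + 1) (n + 1 + 1)).map
        ((ChSt.toCh t).map φ)) ↔ arrowQuasiIsos A (midMap φ n) :=
  Tilt.HomologyPresentation.quasiIso_iff (S := ((ChSt.toCh t).obj X).sc' n (n + 1) (n + 1 + 1))
    (S' := ((ChSt.toCh t).obj Y).sc' n (n + 1) (n + 1 + 1))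
    (R := presentation X n) (R' := presentation Y n)
    (f := ChSt.Hom.f φ (n + 1)) rfl (mapC_mid φ n)
    (by
      change ((rep X n).ι ≫ (cut X n).p) ≫ mapC φ n = _ ≫ (rep Y n).ι ≫ (cut Y n).p
      rw [Category.assoc, p_mapC, reassoc_of% ι_map])
    (k_mapW φ (n + 1)).symm
    (by
      change mapW φ (n + 1) ≫ (cut Y (n + 1)).w ≫ (rep Y (n + 1)).σ =
        ((cut X (n + 1)).w ≫ (rep X (n + 1)).σ) ≫ _
      rw [reassoc_of% mapW_w, map_σ, Category.assoc])

lemma quasiIsoAt_aux_iff :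
    QuasiIsoAt (Dec.Hom.φ ((aux t).map φ)) (n + 1) ↔
      IsIso (cokernel.map _ _ (mapC φ n) (mapW φ (n + 1)) (mapC_mid φ n).symm) ∧
        IsIso (kernel.map _ _ (mapC φ (n + 1)) (mapW φ (n + 1 + 1))
          (mapC_mid φ (n + 1)).symm) := by
  rw [quasiIsoAt_iff' _ n (n + 1) (n + 1 + 1) (by simp) (by simp)]
  exact HomologyCut.quasiIso_iff (D := homologyCut X n) (D' := homologyCut Y n)
    (t.hom_eq_zero (presentation Y n).cutFromCoker.T_mem
      (presentation X (n + 1)).cutToKer.F_mem)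
    (mapW_w φ (n + 1)) (p_mapC φ (n + 1)) _ _

end

lemma hasHomology_sc' (X : ChSt t) (n : ℤ) : (X.cx.sc' n (n + 1) (n + 1 + 1)).HasHomology :=
  (presentation X n).hasHomology

lemma hasHomology (X : ChSt t) (n : ℤ) : X.cx.HasHomology (n + 1) :=
  have := hasHomology_sc' X n
  ShortComplex.hasHomology_of_iso
    (X.cx.isoSc' n (n + 1) (n + 1 + 1) (by simp) (by simp)).symm

lemma qis_iff {X Y : ChSt t} (φ : X ⟶ Y) :
    ChSt.qis t φ ↔ ∀ n, arrowQuasiIsos A (midMap φ n) := by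
  rw [ChSt.qis, ← forall_int_add_one_iff]
  refine forall_congr' fun n => ?_
  have hX : ((ChSt.toCh t).obj X).HasHomology (n + 1) := hasHomology X n
  have hY : ((ChSt.toCh t).obj Y).HasHomology (n + 1) := hasHomology Y n
  have : (((ChSt.toCh t).obj X).sc' n (n + 1) (n + 1 + 1)).HasHomology := hasHomology_sc' X n
  have : (((ChSt.toCh t).obj Y).sc' n (n + 1) (n + 1 + 1)).HasHomology := hasHomology_sc' Y n
  simp only [exists_prop_of_true hX, exists_prop_of_true hY]
  rw [quasiIsoAt_iff' _ n (n + 1) (n + 1 + 1) (by simp) (by simp)]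
  exact quasiIso_sc'_iff φ n

lemma quasiIso_aux_iff {X Y : ChSt t} (φ : X ⟶ Y) :
    QuasiIso (Dec.Hom.φ ((aux t).map φ)) ↔ ∀ n, arrowQuasiIsos A (midMap φ n) := by
  have hker : (∀ n, IsIso (kernel.map _ _ (mapC φ (n + 1)) (mapW φ (n + 1 + 1))
      (mapC_mid φ (n + 1)).symm)) ↔
      ∀ n, IsIso (kernel.map _ _ (mapC φ n) (mapW φ (n + 1)) (mapC_mid φ n).symm) :=
    forall_int_add_one_iff (p := fun n =>
      IsIso (kernel.map _ _ (mapC φ n) (mapW φ (n + 1)) (mapC_mid φ n).symm))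
  rw [quasiIso_iff, ← forall_int_add_one_iff]
  simp only [quasiIsoAt_aux_iff, forall_and]
  rw [hker, and_comm, ← forall_and]
  rfl

lemma quasiIso_reindex_iff {E F : Dec A} (α : E ⟶ F) :
    QuasiIso (Dec.Hom.φ (Dec.reindex.map α)) ↔ QuasiIso (Dec.Hom.φ α) := by
  have key (m : ℤ) : QuasiIsoAt (Dec.Hom.φ (Dec.reindex.map α)) m ↔
      QuasiIsoAt (Dec.Hom.φ α) (m - 1) := by
    rw [quasiIsoAt_iff' _ (m - 1) m (m + 1) (by simp) (by simp),
      quasiIsoAt_iff' _ (m - 1 - 1) (m - 1) (m + 1 - 1) (by simp) (by simp)]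
    rfl
  rw [quasiIso_iff, quasiIso_iff]
  refine ⟨fun h n => ?_, fun h n => (key n).2 (h _)⟩
  have := (key (n + 1)).1 (h _)
  rwa [add_sub_cancel_right] at this

lemma qis_map_iff {X Y : ChSt t} (φ : X ⟶ Y) :
    ChDec.qis t ((Tot t).map φ) ↔ ChSt.qis t φ := by
  rw [qis_iff, ← quasiIso_aux_iff, ← quasiIso_reindex_iff]
  rfl

end Tot

/-! ### Strict isomorphisms -/

namespace Dec

/-- The map `M i ⟶ E j / M j` induced by the differential, as a functor to two-term complexes. -/
def dbarFunctor (i j : ℤ) : Dec A ⥤ Arrow A where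
  obj E := Arrow.mk (E.dbar i j)
  map α := Arrow.homMk (mapM α i) (mapQ α j) (dbar_comm α i j).symm
  map_id E := by
    ext
    · change mapM (𝟙 E) i = 𝟙 _
      rw [← cancel_mono (E.M i).arrow, mapM_arrow, Category.id_comp]
      exact Category.comp_id _
    · change mapQ (𝟙 E) j = 𝟙 _
      rw [← cancel_epi (cokernel.π _), mapQ, cokernel.π_desc, Category.comp_id]
      exact Category.id_comp _
  map_comp {E F G} α β := by
    ext
    · change mapM (α ≫ β) i = mapM α i ≫ mapM β i
      rw [← cancel_mono (G.M i).arrow, mapM_arrow, Category.assoc, mapM_arrow, ← Category.assoc,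
        mapM_arrow, Category.assoc]
      rfl
    · change mapQ (α ≫ β) j = mapQ α j ≫ mapQ β j
      rw [← cancel_epi (cokernel.π _), mapQ, mapQ, mapQ, cokernel.π_desc, cokernel.π_desc_assoc,
        Category.assoc, cokernel.π_desc, ← Category.assoc]
      rfl

/-- The functor sending a decorated complex to its underlying complex. -/
def forget : Dec A ⥤ CochainComplex A ℤ where
  obj E := E.cx
  map α := Hom.φ α

end Dec

namespace ChDec

variable (t : TorsionPair A)

lemma sis_eq : sis t = ⨅ n : ℤ,
    (arrowQuasiIsos A).inverseImage ((Dec.compatible t).ι ⋙ Dec.dbarFunctor n (n + 1)) := by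
  ext E F α
  rw [MorphismProperty.iInf_iff]
  rfl

lemma qis_eq : qis t =
    (HomologicalComplex.quasiIso A (.up ℤ)).inverseImage ((Dec.compatible t).ι ⋙ Dec.forget) :=
  rfl

instance : (sis t).RespectsIso := by
  rw [sis_eq]
  infer_instance

instance : (qis t).RespectsIso := by
  rw [qis_eq]
  infer_instance

end ChDec

namespace Tot

variable {t : TorsionPair A}

/-- The two-term complex `X (i + 1)` is recovered from `Tot X`. -/
def dbarIso (X : ChSt t) (i : ℤ) :
    (Dec.dbarFunctor i (i + 1)).obj ((aux t).obj X) ≅ (X.cx.X (i + 1)).arrow :=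
  Arrow.isoMk (Subobject.underlyingIso (rep X i).ι) (quotIso (rep X (i + 1)))
    (dbar_auxObj X i).symm

section

variable {X Y X' Y' : Arrow A} {P : Butterfly X Y} {P' : Butterfly X' Y'} {g : P.E ⟶ P'.E}

lemma factorThru_underlyingIso {l : Y.left ⟶ Y'.left} (hl : P.ι ≫ g = l ≫ P'.ι)
    (h : (Subobject.mk P'.ι).Factors ((Subobject.mk P.ι).arrow ≫ g)) :
    (Subobject.mk P'.ι).factorThru _ h ≫ (Subobject.underlyingIso P'.ι).hom =
      (Subobject.underlyingIso P.ι).hom ≫ l := by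
  rw [← cancel_mono P'.ι, Category.assoc, Category.assoc, ← hl,
    Subobject.underlyingIso_hom_comp_eq_mk, Subobject.underlyingIso_hom_comp_eq_mk_assoc,
    Subobject.factorThru_arrow]

lemma cokernelMap_quotIso {r : X.right ⟶ X'.right} (hr : g ≫ P'.σ = P.σ ≫ r)
    (m : (Subobject.mk P.ι : A) ⟶ (Subobject.mk P'.ι : A))
    (hm : (Subobject.mk P.ι).arrow ≫ g = m ≫ (Subobject.mk P'.ι).arrow) :
    cokernel.map _ _ m g hm ≫ (quotIso P').hom = (quotIso P).hom ≫ r := by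
  rw [← cancel_epi (cokernel.π _)]
  simp [quotIso, hr]

end

lemma dbarIso_hom_naturality {X Y : ChSt t} (φ : X ⟶ Y) (i : ℤ) :
    (Dec.dbarFunctor i (i + 1)).map ((aux t).map φ) ≫ (dbarIso Y i).hom =
      (dbarIso X i).hom ≫ ChSt.Hom.f φ (i + 1) := by
  ext
  · exact factorThru_underlyingIso (ι_map φ i) (factors_map φ i)
  · exact cokernelMap_quotIso (map_σ φ (i + 1)) (Dec.mapM ((aux t).map φ) (i + 1))
      (Dec.mapM_arrow ((aux t).map φ) (i + 1)).symm

lemma arrowQuasiIsos_dbar_iff {X Y : ChSt t} (φ : X ⟶ Y) (i j : ℤ) (h : i + 1 = j) :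
    arrowQuasiIsos A ((Dec.dbarFunctor i j).map ((aux t).map φ)) ↔
      arrowQuasiIsos A (ChSt.Hom.f φ j) := by
  subst h
  exact (arrowQuasiIsos A).arrow_mk_iso_iff
    (Arrow.isoMk (dbarIso X i) (dbarIso Y i) (dbarIso_hom_naturality φ i).symm)

lemma sis_iff {X Y : ChSt t} (φ : X ⟶ Y) :
    ChSt.sis t φ ↔ ∀ n, arrowQuasiIsos A (ChSt.Hom.f φ n) := by
  simp only [← Tilt.isIso_strict_iff]
  constructor
  · intro h n
    have : IsIso ((ChSt.toCh t).map φ) := h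
    exact inferInstanceAs (IsIso (((ChSt.toCh t).map φ).f n))
  · intro h
    have (n : ℤ) : IsIso (((ChSt.toCh t).map φ).f n) := h n
    exact HomologicalComplex.Hom.isIso_of_components ((ChSt.toCh t).map φ)

lemma sis_map_iff {X Y : ChSt t} (φ : X ⟶ Y) :
    ChDec.sis t ((Tot t).map φ) ↔ ChSt.sis t φ := by
  have key (n : ℤ) :
      arrowQuasiIsos A ((Dec.dbarFunctor n (n + 1)).map ((Tot t).map φ).hom) ↔
        arrowQuasiIsos A (ChSt.Hom.f φ (n + 1 - 1)) :=
    arrowQuasiIsos_dbar_iff φ (n - 1) (n + 1 - 1) (by omega)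
  rw [sis_iff]
  refine forall_congr' fun n => (key n).trans ?_
  rw [add_sub_cancel_right]

end Tot

/-! ### `Tot` is an equivalence -/

lemma factors_mk_arrow_comp_iff {C : Type*} [Category* C] {X Y Z : C} (f : X ⟶ Y) [Mono f]
    (g : Y ⟶ Z) (N : Subobject Z) :
    N.Factors ((Subobject.mk f).arrow ≫ g) ↔ N.Factors (f ≫ g) := by
  constructor <;> intro h
  · have := Subobject.factors_of_factors_right (Subobject.underlyingIso f).inv h
    rwa [Subobject.underlyingIso_arrow_assoc] at this
  · have := Subobject.factors_of_factors_right (Subobject.underlyingIso f).hom h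
    rwa [Subobject.underlyingIso_hom_comp_eq_mk_assoc] at this

lemma exists_forall_add_one_eq {β : ℤ → Sort*} (a : ∀ n, β (n + 1)) :
    ∃ f : ∀ n, β n, ∀ n, f (n + 1) = a n :=
  ⟨(Equiv.addRight (1 : ℤ)).piCongrLeft β a,
    Equiv.piCongrLeft_apply_apply β (Equiv.addRight (1 : ℤ)) a⟩

namespace Butterfly

variable {X Y Z W : Arrow A}

-- `((σ, 0), φ)` maps `P.E` to the pullback whose quotient is the middle object of the composite.
lemma comp_ofHom_equiv_ofHom_comp {P : Butterfly X Y} {g : Y ⟶ Z} {f : X ⟶ W} {Q : Butterfly W Z}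
    (φ : P.E ⟶ Q.E) (hκ : P.κ ≫ φ = f.left ≫ Q.κ) (hι : P.ι ≫ φ = g.left ≫ Q.ι)
    (hσ : φ ≫ Q.σ = P.σ ≫ f.right) (hρ : φ ≫ Q.ρ = P.ρ ≫ g.right) :
    comp P (ofHom g) ≈ comp (ofHom f) Q := by
  have hc := isComp_comp (ofHom f) Q
  obtain ⟨m, hfst, hsnd⟩ : ∃ m : P.E ⟶ pullback (ofHom f).ρ Q.σ,
      m ≫ pullback.fst _ _ = biprod.lift P.σ 0 ∧ m ≫ pullback.snd _ _ = φ :=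
    ⟨pullback.lift (biprod.lift P.σ 0) φ (by simp [hσ]), pullback.lift_fst _ _ _,
      pullback.lift_snd _ _ _⟩
  have κ_m : P.κ ≫ m = compκ (ofHom f) Q + f.left ≫ compRel (ofHom f) Q := by
    apply pullback.hom_ext
    · rw [Category.assoc, hfst, Preadditive.add_comp, compκ_fst, Category.assoc, compRel_fst]
      apply biprod.hom_ext <;> simp [P.κ_σ]
    · rw [Category.assoc, hsnd, Preadditive.add_comp, compκ_snd, Category.assoc, compRel_snd,
        hκ, zero_add]
  have ι_m : P.ι ≫ m = g.left ≫ compι (ofHom f) Q := by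
    apply pullback.hom_ext
    · rw [Category.assoc, hfst, Category.assoc, compι_fst]
      apply biprod.hom_ext <;> simp [P.ι_σ]
    · rw [Category.assoc, hsnd, Category.assoc, compι_snd, hι]
  refine comp_ofHom_equiv (m ≫ compπ (ofHom f) Q) ?_ ?_ ?_ ?_
  · rw [reassoc_of% κ_m, Preadditive.add_comp, Category.assoc, hc.rel, hc.κ, comp_zero, add_zero]
  · rw [reassoc_of% ι_m, hc.ι]
  · rw [Category.assoc, hc.σ, reassoc_of% hfst]
    simp
  · rw [Category.assoc, hc.ρ, reassoc_of% hsnd, hρ]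

end Butterfly

namespace Dec

/-- The isomorphism of decorated complexes given by an isomorphism of complexes that respects the
decorations in both directions. -/
def isoMk {E F : Dec A} (e : E.cx ≅ F.cx)
    (h : ∀ n, (F.M n).Factors ((E.M n).arrow ≫ e.hom.f n))
    (h' : ∀ n, (E.M n).Factors ((F.M n).arrow ≫ e.inv.f n)) : E ≅ F where
  hom := { φ := e.hom, factors := h }
  inv := { φ := e.inv, factors := h' }
  hom_inv_id := Hom.ext e.hom_inv_id
  inv_hom_id := Hom.ext e.inv_hom_id

/-- The reindexing `(E, M) ↦ (E', M')` with `E' n = E (n + 1)` and `M' n = M (n + 1)`, an inverse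
of `Dec.reindex` up to isomorphism. -/
def unindex : Dec A ⥤ Dec A where
  obj E :=
    { cx :=
        { X := fun n => E.cx.X (n + 1)
          d := fun i j => E.cx.d (i + 1) (j + 1)
          shape := fun i j hij => E.cx.shape _ _ fun h => hij (by
            simp only [ComplexShape.up_Rel] at h ⊢
            omega)
          d_comp_d' := fun _ _ _ _ _ => E.cx.d_comp_d _ _ _ }
      M := fun n => E.M (n + 1) }
  map α :=
    { φ :=
        { f := fun n => (Hom.φ α).f (n + 1)
          comm' := fun i j _ => (Hom.φ α).comm (i + 1) (j + 1) }
      factors := fun n => Hom.factors α (n + 1) }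
  map_id _ := rfl
  map_comp _ _ := rfl

lemma factors_XIsoOfEq (E : Dec A) {i j : ℤ} (h : i = j) :
    (E.M j).Factors ((E.M i).arrow ≫ (E.cx.XIsoOfEq h).hom) := by
  subst h
  rw [HomologicalComplex.XIsoOfEq_rfl, Iso.refl_hom, Category.comp_id]
  exact (E.M i).factors_self

/-- Reindexing by `n ↦ n + 1` and then by `n ↦ n - 1` is isomorphic to the identity. -/
def unindexReindexIso : unindex ⋙ reindex ≅ 𝟭 (Dec A) :=
  NatIso.ofComponents
    (fun E => isoMk (E := reindex.obj (unindex.obj E))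
      (HomologicalComplex.Hom.isoOfComponents (fun n => E.cx.XIsoOfEq (sub_add_cancel n 1))
        fun _ j _ => (E.cx.XIsoOfEq_hom_comp_d _ j).trans (E.cx.d_comp_XIsoOfEq_hom _ _).symm)
      (fun n => E.factors_XIsoOfEq (sub_add_cancel n 1))
      (fun n => E.factors_XIsoOfEq (sub_add_cancel n 1).symm))
    fun α => Hom.ext <| HomologicalComplex.hom_ext _ _ fun n =>
      HomologicalComplex.XIsoOfEq_hom_naturality (Hom.φ α) (sub_add_cancel n 1)

/-- Reindexing by `n ↦ n - 1` and then by `n ↦ n + 1` is isomorphic to the identity. -/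
def reindexUnindexIso : reindex ⋙ unindex ≅ 𝟭 (Dec A) :=
  NatIso.ofComponents
    (fun E => isoMk (E := unindex.obj (reindex.obj E))
      (HomologicalComplex.Hom.isoOfComponents (fun n => E.cx.XIsoOfEq (add_sub_cancel_right n 1))
        fun _ j _ => (E.cx.XIsoOfEq_hom_comp_d _ j).trans (E.cx.d_comp_XIsoOfEq_hom _ _).symm)
      (fun n => E.factors_XIsoOfEq (add_sub_cancel_right n 1))
      (fun n => E.factors_XIsoOfEq (add_sub_cancel_right n 1).symm))
    fun α => Hom.ext <| HomologicalComplex.hom_ext _ _ fun n =>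
      HomologicalComplex.XIsoOfEq_hom_naturality (Hom.φ α) (add_sub_cancel_right n 1)

instance : (reindex : Dec A ⥤ Dec A).IsEquivalence :=
  (CategoryTheory.Equivalence.mk reindex unindex reindexUnindexIso.symm
    unindexReindexIso).isEquivalence_functor

/-- The butterfly with middle object `E j` between the two-term complexes `M i ⟶ E j / M j` and
`M j ⟶ E k / M k`. -/
def butterfly (E : Dec A) (i j k : ℤ) :
    Butterfly (Arrow.mk (E.dbar i j)) (Arrow.mk (E.dbar j k)) where
  E := E.cx.X j
  κ := (E.M i).arrow ≫ E.cx.d i j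
  ι := (E.M j).arrow
  σ := cokernel.π (E.M j).arrow
  ρ := E.cx.d j k ≫ cokernel.π (E.M k).arrow
  κ_σ := by simp [dbar]
  ι_ρ := by simp [dbar]
  κ_ρ := by simp
  ι_σ := cokernel.condition _
  exact := { exact := ShortComplex.exact_cokernel _ }

lemma isLink_d (E : Dec A) (i j k l : ℤ) :
    (E.butterfly i j k).IsLink (E.butterfly j k l) (E.cx.d j k) where
  κ_comp := by
    change ((E.M i).arrow ≫ E.cx.d i j) ≫ E.cx.d j k = 0
    rw [Category.assoc, E.cx.d_comp_d, comp_zero]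
  ι_comp := rfl
  comp_σ := rfl
  comp_ρ := E.cx.d_comp_d_assoc j k l _ |>.trans zero_comp

end Dec

namespace Tot

variable {t : TorsionPair A}

instance : (aux t).Faithful where
  map_injective {X Y} φ ψ h := by
    have hmap (n : ℤ) : map φ n = map ψ n := congrArg (fun α => (Dec.Hom.φ α).f n) h
    refine ChSt.Hom.ext (funext fun n => ?_)
    ext
    · obtain ⟨n, rfl⟩ : ∃ m, n = m + 1 := ⟨n - 1, by simp⟩
      rw [← cancel_mono (rep Y n).ι, ← ι_map, ← ι_map, hmap]
    · rw [← cancel_epi (rep X n).σ, ← map_σ, ← map_σ, hmap]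

lemma exists_map_eq {X Y : ChSt t} (f : ∀ n, (X.cx.X n).arrow ⟶ (Y.cx.X n).arrow)
    (g : ∀ n, (rep X n).E ⟶ (rep Y n).E)
    (hκ : ∀ n, (rep X n).κ ≫ g n = (f n).left ≫ (rep Y n).κ)
    (hι : ∀ n, (rep X n).ι ≫ g n = (f (n + 1)).left ≫ (rep Y n).ι)
    (hσ : ∀ n, g n ≫ (rep Y n).σ = (rep X n).σ ≫ (f n).right)
    (hρ : ∀ n, g n ≫ (rep Y n).ρ = (rep X n).ρ ≫ (f (n + 1)).right) :
    ∃ φ : X ⟶ Y, ∀ n, map φ n = g n := by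
  have comm (n : ℤ) : Tilt.strict (f n) ≫ Y.cx.d n (n + 1) =
      X.cx.d n (n + 1) ≫ Tilt.strict (f (n + 1)) := by
    have := (Tilt.ofB_eq_iff (X := X.cx.X n) (Y := Y.cx.X (n + 1)) _ _).2
      (Butterfly.comp_ofHom_equiv_ofHom_comp (g n) (hκ n) (hι n) (hσ n) (hρ n))
    rw [← Tilt.ofB_comp, ← Tilt.ofB_comp, rep, rep, Tilt.ofB_out, Tilt.ofB_out] at this
    exact this.symm
  refine ⟨⟨f, fun i j => ?_⟩, fun n => map_ext n ?_ ?_ ?_ ?_⟩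
  · by_cases h : i + 1 = j
    · subst h
      exact comm i
    · rw [X.cx.shape i j h, Y.cx.shape i j h, comp_zero, zero_comp]
  · rw [κ_map, hκ]
  · rw [ι_map, hι]
  · rw [map_σ, hσ]
  · rw [map_ρ, hρ]

-- The component in degree `n + 1` of the preimage of `g`: it is induced by `g n` on the
-- decoration and by `g (n + 1)` on the quotient by the decoration.
lemma exists_component {X Y : ChSt t} (g : ∀ n, (rep X n).E ⟶ (rep Y n).E)
    (comm : ∀ n, g n ≫ δ Y n = δ X n ≫ g (n + 1))
    (factors : ∀ n, (Subobject.mk (rep Y n).ι).Factors ((rep X n).ι ≫ g n)) (n : ℤ) :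
    ∃ a : (X.cx.X (n + 1)).arrow ⟶ (Y.cx.X (n + 1)).arrow,
      (rep X n).ι ≫ g n = a.left ≫ (rep Y n).ι ∧
      g n ≫ (rep Y n).ρ = (rep X n).ρ ≫ a.right ∧
      (rep X (n + 1)).κ ≫ g (n + 1) = a.left ≫ (rep Y (n + 1)).κ ∧
      g (n + 1) ≫ (rep Y (n + 1)).σ = (rep X (n + 1)).σ ≫ a.right := by
  have exists_left (n : ℤ) : ∃ l : (X.cx.X (n + 1)).arrow.left ⟶ (Y.cx.X (n + 1)).arrow.left,
      l ≫ (rep Y n).ι = (rep X n).ι ≫ g n := (Subobject.mk_factors_iff _ _).1 (factors n)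
  choose l hl using exists_left
  obtain ⟨r, hr⟩ : ∃ r, (rep X (n + 1)).σ ≫ r = g (n + 1) ≫ (rep Y (n + 1)).σ := by
    have h0 : (rep X (n + 1)).ι ≫ g (n + 1) ≫ (rep Y (n + 1)).σ = 0 := by
      rw [← reassoc_of% hl, (rep Y (n + 1)).ι_σ, comp_zero]
    exact ⟨(rep X (n + 1)).exact.exact.desc _ h0, (rep X (n + 1)).exact.exact.g_desc _ h0⟩
  have hκ : (rep X (n + 1)).κ ≫ g (n + 1) = l n ≫ (rep Y (n + 1)).κ := by
    rw [← ι_δ, Category.assoc, ← comm, ← reassoc_of% hl, ι_δ]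
  have hρ : g n ≫ (rep Y n).ρ = (rep X n).ρ ≫ r := by
    rw [← δ_σ, ← δ_σ, reassoc_of% comm, Category.assoc, hr]
  have hlr : l n ≫ (Y.cx.X (n + 1)).arrow.hom = (X.cx.X (n + 1)).arrow.hom ≫ r := by
    rw [← (rep X n).ι_ρ, Category.assoc, ← hρ, ← reassoc_of% hl, (rep Y n).ι_ρ]
  exact ⟨Arrow.homMk (l n) r hlr, (hl n).symm, hρ, hκ, hr.symm⟩

instance : (aux t).Full where
  map_surjective {X Y} α := by
    let g (n : ℤ) : (rep X n).E ⟶ (rep Y n).E := (Dec.Hom.φ α).f n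
    have comm (n : ℤ) : g n ≫ δ Y n = δ X n ≫ g (n + 1) := by
      rw [← auxObj_d, ← auxObj_d]
      exact (Dec.Hom.φ α).comm n (n + 1)
    choose a hι hρ hκ hσ using exists_component g comm fun n =>
      (factors_mk_arrow_comp_iff _ _ _).1 (Dec.Hom.factors α n)
    obtain ⟨f, hf⟩ := exists_forall_add_one_eq
      (β := fun n => (X.cx.X n).arrow ⟶ (Y.cx.X n).arrow) a
    obtain ⟨φ, hφ⟩ := exists_map_eq f g
      (forall_int_add_one_iff.1 fun n => by rw [hf, hκ]) (fun n => by rw [hf, hι])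
      (forall_int_add_one_iff.1 fun n => by rw [hf, hσ]) (fun n => by rw [hf, hρ])
    exact ⟨φ, Dec.Hom.ext (HomologicalComplex.hom_ext _ _ hφ)⟩

/-- The complex in `B` recovered from a decorated complex: its term in degree `n` is the two-term
complex `M n ⟶ E (n + 1) / M (n + 1)`. -/
def ofDec (E : ChDec t) : ChSt t where
  cx := CochainComplex.of
    (fun n => { arrow := Arrow.mk (E.obj.dbar n (n + 1))
                ker_mem := (E.property n).1
                coker_mem := (E.property n).2 })
    (fun n => Tilt.ofB (E.obj.butterfly n (n + 1) (n + 1 + 1)))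
    (fun n => by
      rw [Tilt.ofB_comp, Tilt.zero_def, Tilt.ofB_eq_iff]
      exact (E.obj.isLink_d n (n + 1) (n + 1 + 1) (n + 1 + 1 + 1)).comp_equiv_zero)

lemma rep_ofDec (E : ChDec t) (n : ℤ) :
    rep (ofDec E) n ≈ E.obj.butterfly n (n + 1) (n + 1 + 1) := by
  refine (Tilt.ofB_eq_iff (X := (ofDec E).cx.X n) (Y := (ofDec E).cx.X (n + 1)) _ _).1 ?_
  rw [rep, Tilt.ofB_out]
  exact CochainComplex.of_d (fun n => (⟨Arrow.mk (E.obj.dbar n (n + 1)), (E.property n).1,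
    (E.property n).2⟩ : Tilt t)) (fun n => Tilt.ofB (E.obj.butterfly n (n + 1) (n + 1 + 1))) n

lemma nonempty_aux_ofDec_iso (E : ChDec t) :
    Nonempty ((aux t).obj (ofDec E) ≅ Dec.unindex.obj E.obj) := by
  choose e hκ hι hσ hρ using rep_ofDec E
  have comm (n : ℤ) : (e n).hom ≫ E.obj.cx.d (n + 1) (n + 1 + 1) =
      δ (ofDec E) n ≫ (e (n + 1)).hom :=
    (isLink_δ (ofDec E) n).naturality (P' := E.obj.butterfly n (n + 1) (n + 1 + 1))
      (Q' := E.obj.butterfly (n + 1) (n + 1 + 1) (n + 1 + 1 + 1)) (E.obj.isLink_d _ _ _ _) t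
      ((ofDec E).cx.X n).coker_mem ((ofDec E).cx.X (n + 1 + 1)).ker_mem
      (hκ n) (hι n) (hρ n) (hκ (n + 1)) (hσ (n + 1)) (hρ (n + 1))
  refine ⟨Dec.isoMk (HomologicalComplex.Hom.isoOfComponents e ?_) (fun n => ?_) (fun n => ?_)⟩
  · rintro i _ rfl
    exact (comm i).trans (congrArg (· ≫ _) (auxObj_d (ofDec E) i).symm)
  · refine (factors_mk_arrow_comp_iff (rep (ofDec E) n).ι (e n).hom (E.obj.M (n + 1))).2 ?_
    exact (hι n).symm ▸ (E.obj.M (n + 1)).factors_self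
  · have h : (E.obj.M (n + 1)).arrow ≫ (e n).inv = (rep (ofDec E) n).ι :=
      (Iso.comp_inv_eq _).2 (hι n).symm
    exact h.symm ▸ Subobject.mk_factors_self (rep (ofDec E) n).ι

instance : (Tot t).EssSurj where
  mem_essImage E := by
    obtain ⟨e⟩ := nonempty_aux_ofDec_iso E
    exact ⟨ofDec E, ⟨(Dec.compatible t).isoMk
      (Dec.reindex.mapIso e ≪≫ Dec.unindexReindexIso.app E.obj)⟩⟩

instance : (Tot t).Faithful :=
  Functor.Faithful.of_comp_iso ((Dec.compatible t).liftCompιIso (aux t ⋙ Dec.reindex) _)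

instance : (Tot t).Full :=
  Functor.Full.of_comp_faithful_iso
    ((Dec.compatible t).liftCompιIso (aux t ⋙ Dec.reindex) _)

instance : (Tot t).IsEquivalence where

end Tot

end HRSTilt

end

theorem theoremT {A : Type u} [CategoryTheory.Category.{v} A] [CategoryTheory.Abelian A]
    (t : HRSTilt.TorsionPair A) :
    (HRSTilt.Tot t).IsEquivalence ∧
      ((HRSTilt.ChSt.sis t).map (HRSTilt.Tot t) = HRSTilt.ChDec.sis t ∧
        (HRSTilt.ChDec.sis t).inverseImage (HRSTilt.Tot t) = HRSTilt.ChSt.sis t) ∧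
      ((HRSTilt.ChSt.qis t).map (HRSTilt.Tot t) = HRSTilt.ChDec.qis t ∧
        (HRSTilt.ChDec.qis t).inverseImage (HRSTilt.Tot t) = HRSTilt.ChSt.qis t) := by
  have h₁ : (HRSTilt.ChDec.sis t).inverseImage (HRSTilt.Tot t) = HRSTilt.ChSt.sis t := by
    ext X Y φ
    exact HRSTilt.Tot.sis_map_iff φ
  have h₂ : (HRSTilt.ChDec.qis t).inverseImage (HRSTilt.Tot t) = HRSTilt.ChSt.qis t := by
    ext X Y φ
    exact HRSTilt.Tot.qis_map_iff φ
  refine ⟨inferInstance, ⟨?_, h₁⟩, ⟨?_, h₂⟩⟩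
  · rw [← h₁, MorphismProperty.map_inverseImage_eq_of_isEquivalence]
  · rw [← h₂, MorphismProperty.map_inverseImage_eq_of_isEquivalence]
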